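/- Let $\sigma\in\mathbb{R}$, let $\mathbf{q}_0\in\mathbb{C}^2$ be nonzero, $q_0=\Vert\mathbf{q}_0\Vert$, $\delta_\pm\in\mathbb{R}$ and $\mathbf{q}_\pm=\mathbf{q}_0\mathrm{e}^{\mathrm{i}\delta_\pm}$. Let $\mathbf{q}:\mathbb{R}\times\mathbb{R}\to\mathbb{C}^2$, $(x,t)\mapsto\mathbf{q}(x,t)$, and put $$\mathbf{J}=\operatorname{diag}(1,-1,-1),\quad \mathbf{Q}[\mathbf{v}]=\begin{pmatrix}0&-\mathbf{v}^\dagger\\ \mathbf{v}&\mathbf{0}_{2\times2}\end{pmatrix}\ (\mathbf{v}\in\mathbb{C}^2),\quad \mathbf{X}=\mathrm{i}k\mathbf{J}+\mathrm{i}\mathbf{Q}[\mathbf{q}(x,t)],\quad \mathbf{X}_\pm=\mathrm{i}k\mathbf{J}+\mathrm{i}\mathbf{Q}[\mathbf{q}_\pm],$$ where, for $z\in\mathbb{C}\setminus\{0\}$, $k=\frac12(z+q_0^2/z)$ and $\lambda=\frac12(z-q_0^2/z)$. Let $$\mathbf{Y}_\pm(z)=\begin{pmatrix}\mathrm{i}&0&q_0/z\\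 \mathrm{i}\mathbf{q}_\pm/z&\mathbf{q}_\pm^\perp/q_0&\mathbf{q}_\pm/q_0\end{pmatrix},\qquad (v_1,v_2)^{T\,\perp}=(\bar v_2,-\bar v_1)^T,$$ $\mathbf{\Lambda}_1=\operatorname{diag}(\lambda,-k,-\lambda)$, $\theta=2\lambda[k+\sigma(3k^2-\lambda^2)]$, $\mathbf{\Lambda}_2=\operatorname{diag}(\theta,\,-(\lambda^2+k^2+4\sigma k^3),\,-\theta)$ and $\mathbf{\Delta}(z;x,t)=\mathbf{\Lambda}_1x+\mathbf{\Lambda}_2t$. Write $\mathbb{D}^\pm=\{z\in\mathbb{C}:\pm\operatorname{Im}z>0\}$ and $\Sigma=\mathbb{R}\setminus\{0,q_0,-q_0\}$. Fix $t\in\mathbb{R}$. For $z\in\Sigma$, a Jost eigenfunction $\psi_\pm(z;\cdot,t)$ is a continuous $3\times3$ matrix function solving $\psi_x=\mathbf{X}\psi$ on $\mathbb{R}$ (in integrated form) with $\psi_\pm=\mathbf{Y}_\pm\mathrm{e}^{\mathrm{i}\mathbf{\Delta}}+o(1)$ as $x\to\pm\infty$; the modified eigenfunction is $\nu_\pm=\psi_\pm\mathrm{e}^{-\mathrm{i}\mathbf{\Delta}}$,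 with columns $\nu_{\pm,j}$, $j=1,2,3$. **Theorem.** Suppose that $\mathbf{q}(\cdot,t)-\mathbf{q}_-\in L^1(-\infty,a)$ for every $a\in\mathbb{R}$ (respectively, $\mathbf{q}(\cdot,t)-\mathbf{q}_+\in L^1(a,\infty)$ for every $a\in\mathbb{R}$). Then $\psi_-(z;\cdot,t)$ (respectively $\psi_+(z;\cdot,t)$) exists and is unique for every $z\in\Sigma$, and for every $x\in\mathbb{R}$ the column $\nu_{-,1}(\cdot;x,t)$ (respectively $\nu_{+,3}(\cdot;x,t)$) extends from $\Sigma$ to a function that is analytic in $\mathbb{D}^-$ and continuous on $\mathbb{D}^-\cup\Sigma$, while $\nu_{-,3}(\cdot;x,t)$ (respectively $\nu_{+,1}(\cdot;x,t)$) extends from $\Sigma$ to a function that is analytic in $\mathbb{D}^+$ and continuous on $\mathbb{D}^+\cup\Sigma$. The extensions are again columns of modified eigenfunctions: for $z$ in the half-plane in question, the extension $\nu_{\pm,j}(z;x,t)$ is such that $\nu_{\pm,j}\mathrm{e}^{\mathrm{i}\mathbf{\Delta}_{jj}}$ solves $\psi_x=\mathbf{X}\psi$ and $\nu_{\pm,j}$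 tends to the $j$-th column $\mathbf{Y}_{\pm,j}(z)$ of $\mathbf{Y}_\pm(z)$ as $x\to\pm\infty$; and for $z$ in that half-plane or in $\Sigma$, with an absolutely convergent integral, $$\nu_{\pm,j}(z;x,t)=\mathbf{Y}_{\pm,j}+\int_{\pm\infty}^x\mathbf{Y}_\pm\mathrm{e}^{\mathrm{i}(x-y)\mathbf{\Lambda}_1}\mathbf{Y}_\pm^{-1}(\mathbf{X}(z;y,t)-\mathbf{X}_\pm(z))\,\nu_{\pm,j}(z;y,t)\,\mathrm{e}^{-\mathrm{i}(x-y)(\mathbf{\Lambda}_1)_{jj}}\,\mathrm{d}y.$$ -/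

import Mathlib

open MeasureTheory Filter Topology

/-- The space `ℂ²` of values of the potential, with its Hermitian norm. -/
abbrev C2 : Type := EuclideanSpace ℂ (Fin 2)

/-- The two ends `x → -∞` and `x → +∞` of the spatial line. -/
inductive SpatialEnd where
  | minus
  | plus

namespace Hirota

noncomputable section

/-- The filter describing `x → -∞`, respectively `x → +∞`. -/
def endFilter : SpatialEnd → Filter ℝ
  | SpatialEnd.minus => atBot
  | SpatialEnd.plus => atTop

/-- The half-line between the end and the point `a`. -/
def halfLine : SpatialEnd → ℝ → Set ℝ
  | SpatialEnd.minus, a => Set.Iic a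
  | SpatialEnd.plus, a => Set.Ioi a

/-- The oriented integral `∫_{-∞}^x f`, respectively `∫_{+∞}^x f = -∫_x^{+∞} f`. -/
def integralFrom (e : SpatialEnd) (f : ℝ → Fin 3 → ℂ) (x : ℝ) : Fin 3 → ℂ :=
  match e with
  | SpatialEnd.minus => ∫ y in Set.Iic x, f y
  | SpatialEnd.plus => -∫ y in Set.Ioi x, f y

/-- The open upper half-plane. -/
def upperHalf : Set ℂ := {z | 0 < z.im}

/-- The open lower half-plane. -/
def lowerHalf : Set ℂ := {z | z.im < 0}

/-- The real axis of the `z`-plane without `0` and without the branch points `± q₀`. -/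
def realAxis (q₀ : ℝ) : Set ℂ :=
  {z | z.im = 0 ∧ z ≠ 0 ∧ z ≠ (q₀ : ℂ) ∧ z ≠ -(q₀ : ℂ)}

/-- `k(z) = (z + q₀² / z) / 2`. -/
def kOf (q₀ : ℝ) (z : ℂ) : ℂ := (z + (q₀ : ℂ) ^ 2 / z) / 2

/-- `λ(z) = (z - q₀² / z) / 2`. -/
def lam (q₀ : ℝ) (z : ℂ) : ℂ := (z - (q₀ : ℂ) ^ 2 / z) / 2

/-- `J = diag(1, -1, -1)`. -/
def J : Matrix (Fin 3) (Fin 3) ℂ := Matrix.diagonal ![1, -1, -1]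

/-- The block matrix `Q` with first row `(0, -v†)`, first column `(0, v)`, and zeros elsewhere. -/
def Q (v : C2) : Matrix (Fin 3) (Fin 3) ℂ :=
  !![0, -star (v 0), -star (v 1);
     v 0, 0, 0;
     v 1, 0, 0]

/-- `X = i k J + i Q`. -/
def X (k : ℂ) (v : C2) : Matrix (Fin 3) (Fin 3) ℂ :=
  (Complex.I * k) • J + Complex.I • Q v

/-- The eigenvector matrix `Y` of the asymptotic Lax pair with boundary value `v`. The lower block
of its second column is `v^⊥ / q₀`, where `v^⊥ = (v₂, -v₁)†`. -/
def Y (q₀ : ℝ) (v : C2) (z : ℂ) : Matrix (Fin 3) (Fin 3) ℂ :=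
  !![Complex.I, 0, (q₀ : ℂ) / z;
     Complex.I * v 0 / z, star (v 1) / (q₀ : ℂ), v 0 / (q₀ : ℂ);
     Complex.I * v 1 / z, -star (v 0) / (q₀ : ℂ), v 1 / (q₀ : ℂ)]

/-- The diagonal of `Λ₁ = diag(λ, -k, -λ)`. -/
def Lam1 (q₀ : ℝ) (z : ℂ) : Fin 3 → ℂ :=
  ![lam q₀ z, -kOf q₀ z, -lam q₀ z]

/-- The diagonal of `Λ₂`. -/
def Lam2 (σ q₀ : ℝ) (z : ℂ) : Fin 3 → ℂ :=
  ![2 * lam q₀ z * (kOf q₀ z + σ * (3 * kOf q₀ z ^ 2 - lam q₀ z ^ 2)),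
    -(lam q₀ z ^ 2 + kOf q₀ z ^ 2 + 4 * σ * kOf q₀ z ^ 3),
    -(2 * lam q₀ z * (kOf q₀ z + σ * (3 * kOf q₀ z ^ 2 - lam q₀ z ^ 2)))]

/-- The diagonal `(δ₁, δ₂, -δ₁)` of `Δ(z; x, t) = Λ₁ x + Λ₂ t`. -/
def Delta (σ q₀ : ℝ) (z : ℂ) (x t : ℝ) : Fin 3 → ℂ :=
  fun j => Lam1 q₀ z j * x + Lam2 σ q₀ z j * t

/-- The diagonal matrix `exp(i s D)`, where `D` is the diagonal matrix with diagonal `d`. -/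
def expDiag (s : ℂ) (d : Fin 3 → ℂ) : Matrix (Fin 3) (Fin 3) ℂ :=
  Matrix.diagonal fun j => Complex.exp (Complex.I * s * d j)

/-- `φ` solves `φ_x = X(k; x) φ` on the line, for a potential `u` (at a fixed time) that is only
locally integrable: `φ` is continuous and satisfies the integrated equation. For continuous `u`
this is the classical equation. -/
def SolvesSpatial (k : ℂ) (u : ℝ → C2) (φ : ℝ → Fin 3 → ℂ) : Prop :=
  Continuous φ ∧ ∀ a b : ℝ, φ b - φ a = ∫ y in a..b, (X k (u y)).mulVec (φ y)

/-- `ψ` is the Jost eigenfunction `ψ_±(z; ·, t)` at a point `z` of the real axis: every column of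
`ψ` solves the spatial equation, and `ψ = Y_± exp(i Δ) + o(1)` as `x → ± ∞`. Here `v = q_±`. -/
def IsJost (e : SpatialEnd) (σ q₀ : ℝ) (v : C2) (q : ℝ → ℝ → C2) (t : ℝ) (z : ℂ)
    (ψ : ℝ → Matrix (Fin 3) (Fin 3) ℂ) : Prop :=
  (∀ j, SolvesSpatial (kOf q₀ z) (fun x => q x t) (fun x i => ψ x i j)) ∧
    Tendsto (fun x => ψ x - Y q₀ v z * expDiag 1 (Delta σ q₀ z x t)) (endFilter e) (𝓝 0)

/-- The modified eigenfunction `ν = ψ exp(-i Δ)`. -/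
def modified (σ q₀ : ℝ) (t : ℝ) (z : ℂ) (ψ : ℝ → Matrix (Fin 3) (Fin 3) ℂ) (x : ℝ) :
    Matrix (Fin 3) (Fin 3) ℂ :=
  ψ x * expDiag (-1) (Delta σ q₀ z x t)

/-- `w` satisfies the spectral problem for the `j`-th column of `ν_±` at `z`: the function
`w exp(i Δ_j)` solves the spatial equation, and `w` tends to the `j`-th column of `Y_±`. -/
def IsModifiedColumn (e : SpatialEnd) (σ q₀ : ℝ) (v : C2) (q : ℝ → ℝ → C2) (t : ℝ) (j : Fin 3)
    (z : ℂ) (w : ℝ → Fin 3 → ℂ) : Prop :=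
  SolvesSpatial (kOf q₀ z) (fun x => q x t)
      (fun x => Complex.exp (Complex.I * Delta σ q₀ z x t j) • w x) ∧
    Tendsto w (endFilter e) (𝓝 fun i => Y q₀ v z i j)

/-- The integrand of the Volterra equation for the `j`-th column `w` of `ν_±`:
`Y exp(i (x - y) Λ₁) Y⁻¹ (X(y) - X_±) w(y) exp(-i (x - y) (Λ₁)_j)`. -/
def volterraIntegrand (q₀ : ℝ) (v : C2) (q : ℝ → ℝ → C2) (t : ℝ) (j : Fin 3)
    (z : ℂ) (w : ℝ → Fin 3 → ℂ) (x y : ℝ) : Fin 3 → ℂ :=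
  Complex.exp (-(Complex.I * ((x - y : ℝ) : ℂ) * Lam1 q₀ z j)) •
    (Y q₀ v z * expDiag ((x - y : ℝ) : ℂ) (Lam1 q₀ z) * (Y q₀ v z)⁻¹ *
      (X (kOf q₀ z) (q y t) - X (kOf q₀ z) v)).mulVec (w y)

/-- `w` satisfies the `j`-th column of the Volterra integral equation for `ν_±` at `z`, with an
absolutely convergent integral. -/
def SolvesVolterra (e : SpatialEnd) (q₀ : ℝ) (v : C2) (q : ℝ → ℝ → C2) (t : ℝ) (j : Fin 3)
    (z : ℂ) (w : ℝ → Fin 3 → ℂ) : Prop :=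
  ∀ x : ℝ, IntegrableOn (volterraIntegrand q₀ v q t j z w x) (halfLine e x) ∧
    w x = (fun i => Y q₀ v z i j) + integralFrom e (volterraIntegrand q₀ v q t j z w x) x

/-- The `j`-th column of the modified eigenfunction `ν_±(z; x, t)`, given on the real axis, extends
analytically to the open set `U` of the `z`-plane: for every `x` the extension is analytic in `U`
and continuous up to the real axis (away from `0` and `± q₀`), and it agrees there with `ν_±`.
Moreover the extension is the column of the modified eigenfunction for `z ∈ U` as well. -/
def ColumnExtends (e : SpatialEnd) (σ q₀ : ℝ) (v : C2) (q : ℝ → ℝ → C2) (t : ℝ) (j : Fin 3)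
    (U : Set ℂ) : Prop :=
  ∃ F : ℂ → ℝ → Fin 3 → ℂ,
    (∀ x, AnalyticOnNhd ℂ (fun z => F z x) U) ∧
    (∀ x, ContinuousOn (fun z => F z x) (U ∪ realAxis q₀)) ∧
    (∀ z ∈ realAxis q₀, ∀ ψ, IsJost e σ q₀ v q t z ψ →
      ∀ x, F z x = fun i => modified σ q₀ t z ψ x i j) ∧
    (∀ z ∈ U, IsModifiedColumn e σ q₀ v q t j z (F z)) ∧
    (∀ z ∈ U ∪ realAxis q₀, SolvesVolterra e q₀ v q t j z (F z))

end

end Hirota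

/-! The asymptotic matrix `X_±` is diagonalised by `Y_±`, with eigenvalues `i λ, -i k, -i λ`.
Variation of constants turns the spatial equation, together with the normalisation at one end, into
a Volterra equation whose perturbation `X - X_± = i Q[q - q_±]` is integrable up to that end and
does not depend on `z`. For the `j`-th modified column the kernel carries the exponentials `exp(i (x
- y) (Λ_m - Λ_j))`, and everything rests on keeping them bounded by `1`.

Since `k + λ = z` and `k - λ = q₀² / z`, the differences `Λ_m - Λ_j` are `0, -z, -2λ` for the first
column and `2λ, -q₀² / z, 0` for the third. Within each triple the imaginary parts never have
opposite signs when `z` stays in one closed half-plane (`endSign_mul_im_nonneg_first`,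
`endSign_mul_im_nonneg_third`). For the second column they are `z` and `q₀² / z`, with imaginary
parts of opposite signs off the axis, so that column is treated only for real `z`, where all
exponentials are unimodular.

With bounded exponentials the `n`-th Neumann term is at most `B (D ∫ ‖q - q_±‖)^n / n!`, with
constants locally uniform in `z`. Hence the series converges without any smallness condition, and
continuity up to the axis and holomorphy inside pass to the sum (`exists_volterra_solution`). On the
axis the sum is the Jost column: the difference of two candidates solves the spatial equation and
vanishes at the end, so a Grönwall argument kills it (`SolvesSpatial.eq_zero`).

The potential is only locally integrable, so differential equations are read in integrated form, and
the product rule is that of absolutely continuous functions (`IsIndefIntegral.mul`). The end `+∞` is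
reduced to `-∞` by reflection. -/

/-- `F` is an indefinite integral of the locally integrable function `f`. -/
def IsIndefIntegral {𝕜 : Type*} [RCLike 𝕜] (f F : ℝ → 𝕜) : Prop :=
  LocallyIntegrable f ∧ ∀ a b : ℝ, F b - F a = ∫ y in a..b, f y

/-! ### Calculus of primitives of locally integrable functions. -/

namespace IsIndefIntegral

variable {𝕜 : Type*} [RCLike 𝕜] {f g F G : ℝ → 𝕜}

theorem intervalIntegrable (h : LocallyIntegrable f) (a b : ℝ) :
    IntervalIntegrable f volume a b :=
  intervalIntegrable_iff.mpr <|
    (h.integrableOn_isCompact isCompact_uIcc).mono_set Set.uIoc_subset_uIcc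

theorem continuous (h : IsIndefIntegral f F) : Continuous F := by
  have : F = fun x => F 0 + ∫ y in (0 : ℝ)..x, f y := by
    funext x; rw [← h.2 0 x]; ring
  rw [this]
  exact continuous_const.add
    (intervalIntegral.continuous_primitive (fun a b => intervalIntegrable h.1 a b) 0)

theorem absolutelyContinuousOnInterval (h : IsIndefIntegral f F) (a b : ℝ) :
    AbsolutelyContinuousOnInterval F a b := by
  have hc (c : 𝕜) : AbsolutelyContinuousOnInterval (fun _ : ℝ => c) a b :=
    (contDiff_const (𝕜 := ℝ) (n := 1)).contDiffOn.absolutelyContinuousOnInterval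
  have hi := intervalIntegrable h.1 a b
  -- Real and imaginary parts are primitives of real functions; they are recombined with the
  -- constants `1` and `I`.
  have hre : IntervalIntegrable (fun y => RCLike.reCLM (f y)) volume a b :=
    ⟨(RCLike.reCLM (K := 𝕜)).integrable_comp hi.1, (RCLike.reCLM (K := 𝕜)).integrable_comp hi.2⟩
  have him : IntervalIntegrable (fun y => RCLike.imCLM (f y)) volume a b :=
    ⟨(RCLike.imCLM (K := 𝕜)).integrable_comp hi.1, (RCLike.imCLM (K := 𝕜)).integrable_comp hi.2⟩
  have h1 := hre.absolutelyContinuousOnInterval_intervalIntegral (c := a) (by simp)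
  have h2 := him.absolutelyContinuousOnInterval_intervalIntegral (c := a) (by simp)
  have h3 := ((hc (F a)).add (h1.smul (hc 1))).add (h2.smul (hc RCLike.I))
  suffices hF : F = (((fun _ => F a) +
      (fun x => ∫ v in a..x, RCLike.reCLM (f v)) • fun _ => (1 : 𝕜)) +
      (fun x => ∫ v in a..x, RCLike.imCLM (f v)) • fun _ => (RCLike.I : 𝕜)) by
    rw [hF]
    exact h3
  funext x
  have hx := intervalIntegrable h.1 a x
  have e1 := (RCLike.reCLM (K := 𝕜)).intervalIntegral_comp_comm hx
  have e2 := (RCLike.imCLM (K := 𝕜)).intervalIntegral_comp_comm hx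
  simp only [Pi.add_apply, Pi.smul_apply', e1, e2, ← h.2 a x]
  simp only [RCLike.reCLM_apply, RCLike.imCLM_apply, RCLike.real_smul_eq_coe_mul, mul_one]
  rw [add_assoc, RCLike.re_add_im]
  ring

theorem ae_hasDerivAt (h : IsIndefIntegral f F) : ∀ᵐ x, HasDerivAt F (f x) x := by
  filter_upwards [LocallyIntegrable.ae_hasDerivAt_integral h.1] with x hx
  have : F = fun x => F 0 + ∫ y in (0 : ℝ)..x, f y := by
    funext x; rw [← h.2 0 x]; ring
  rw [this]
  exact (hx 0).const_add (F 0)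

theorem mul_locallyIntegrable (hf : LocallyIntegrable f) (hG : Continuous G) :
    LocallyIntegrable (fun x => f x * G x) := by
  have := hf.smul_continuous hG
  simpa [mul_comm] using this

/-- Integration by parts: `F * G` minus the primitive of the expected derivative is absolutely
continuous with derivative zero almost everywhere, hence constant. -/
theorem mul (hF : IsIndefIntegral f F) (hG : IsIndefIntegral g G) :
    IsIndefIntegral (fun x => f x * G x + F x * g x) (fun x => F x * G x) := by
  have h1 : LocallyIntegrable (fun x => f x * G x) := mul_locallyIntegrable hF.1 hG.continuous
  have h2 : LocallyIntegrable (fun x => F x * g x) := by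
    simpa only [mul_comm] using mul_locallyIntegrable hG.1 hF.continuous
  have hl := h1.add h2
  refine ⟨hl, fun a b => ?_⟩
  set P : ℝ → 𝕜 := fun x => ∫ y in a..x, (f y * G y + F y * g y) with hP
  have hPi : IsIndefIntegral (fun x => f x * G x + F x * g x) P := by
    refine ⟨hl, fun c d => ?_⟩
    simp only [hP]
    exact intervalIntegral.integral_interval_sub_left (intervalIntegrable hl _ _)
      (intervalIntegrable hl _ _)
  have hac := ((hF.absolutelyContinuousOnInterval a b).smul
    (hG.absolutelyContinuousOnInterval a b)).sub (hPi.absolutelyContinuousOnInterval a b)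
  obtain ⟨C, hC⟩ := hac.const_of_ae_hasDerivAt_zero (by
    filter_upwards [hF.ae_hasDerivAt, hG.ae_hasDerivAt, hPi.ae_hasDerivAt] with x h1 h2 h3 _
    have := (h1.mul h2).sub h3
    simpa using this)
  have ha := hC a (by simp)
  have hb := hC b (by simp)
  simp only [Pi.sub_apply, smul_eq_mul, Pi.mul_apply] at ha hb
  have hPa : P a = 0 := by simp [hP]
  rw [hPa] at ha
  change F b * G b - F a * G a = P b
  rw [← hb] at ha
  linear_combination (norm := ring_nf) -ha

theorem const (c : 𝕜) : IsIndefIntegral (fun _ => (0 : 𝕜)) (fun _ => c) :=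
  ⟨locallyIntegrable_zero, fun a b => by simp⟩

theorem add (hF : IsIndefIntegral f F) (hG : IsIndefIntegral g G) :
    IsIndefIntegral (fun x => f x + g x) (fun x => F x + G x) := by
  refine ⟨hF.1.add hG.1, fun a b => ?_⟩
  rw [intervalIntegral.integral_add (intervalIntegrable hF.1 a b) (intervalIntegrable hG.1 a b),
    ← hF.2, ← hG.2]
  ring

theorem const_mul (c : 𝕜) (hF : IsIndefIntegral f F) :
    IsIndefIntegral (fun x => c * f x) (fun x => c * F x) := by
  simpa using (const c).mul hF

theorem sum {ι : Type*} (s : Finset ι) {f F : ι → ℝ → 𝕜}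
    (h : ∀ i ∈ s, IsIndefIntegral (f i) (F i)) :
    IsIndefIntegral (fun x => ∑ i ∈ s, f i x) (fun x => ∑ i ∈ s, F i x) := by
  classical
  induction s using Finset.induction_on with
  | empty => simpa using const (𝕜 := 𝕜) 0
  | insert a s ha ih =>
    simp only [Finset.sum_insert ha]
    exact (h a (Finset.mem_insert_self a s)).add
      (ih fun i hi => h i (Finset.mem_insert_of_mem hi))

theorem congr {f' F' : ℝ → 𝕜} (h : IsIndefIntegral f F) (hf : ∀ x, f x = f' x)
    (hF : ∀ x, F x = F' x) : IsIndefIntegral f' F' := by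
  rwa [← funext hf, ← funext hF]

theorem pow (h : IsIndefIntegral f F) (n : ℕ) :
    IsIndefIntegral (fun x => (n + 1) * (f x * F x ^ n)) (fun x => F x ^ (n + 1)) := by
  induction n with
  | zero => simpa using h
  | succ n ih =>
    refine (ih.mul h).congr (fun x => ?_) (fun x => ?_)
    · push_cast; ring
    · ring

end IsIndefIntegral

theorem isIndefIntegral_of_hasDerivAt {𝕜 : Type*} [RCLike 𝕜] {f F : ℝ → 𝕜}
    (h : ∀ x, HasDerivAt F (f x) x) (hf : Continuous f) : IsIndefIntegral f F :=
  ⟨hf.locallyIntegrable, fun a b => (intervalIntegral.integral_eq_sub_of_hasDerivAt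
    (fun x _ => h x) (hf.intervalIntegrable a b)).symm⟩

theorem isIndefIntegral_cexp (c : ℂ) :
    IsIndefIntegral (fun x : ℝ => c * Complex.exp (c * x)) (fun x : ℝ => Complex.exp (c * x)) := by
  refine isIndefIntegral_of_hasDerivAt (fun x => ?_) (by fun_prop)
  have h1 : HasDerivAt (fun x : ℝ => c * (x : ℂ)) c x := by
    simpa using (Complex.ofRealCLM.hasDerivAt (x := x)).const_mul c
  simpa [mul_comm] using h1.cexp

theorem locallyIntegrable_of_integrableOn_Iic {E : Type*} [NormedAddCommGroup E] {f : ℝ → E}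
    (h : ∀ a, IntegrableOn f (Set.Iic a)) : LocallyIntegrable f := fun x =>
  ⟨Set.Iic (x + 1), Iic_mem_nhds (by linarith), h _⟩

theorem isIndefIntegral_setIntegral_Iic {𝕜 : Type*} [RCLike 𝕜] {f : ℝ → 𝕜}
    (h : ∀ a, IntegrableOn f (Set.Iic a)) :
    IsIndefIntegral f (fun x => ∫ y in Set.Iic x, f y) :=
  ⟨locallyIntegrable_of_integrableOn_Iic h, fun a b =>
    intervalIntegral.integral_Iic_sub_Iic (h a) (h b)⟩

/-! ### Iterated integrals of an integrable weight, and Grönwall's lemma. -/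

section Weight

variable {ρ : ℝ → ℝ}

theorem weight_primitive_mono (hρ : ∀ y, 0 ≤ ρ y) (hi : ∀ a, IntegrableOn ρ (Set.Iic a)) :
    Monotone fun x => ∫ y in Set.Iic x, ρ y := fun _ _ hab =>
  setIntegral_mono_set (hi _) (Eventually.of_forall hρ) (Set.Iic_subset_Iic.2 hab).eventuallyLE

theorem weight_primitive_nonneg (hρ : ∀ y, 0 ≤ ρ y) (x : ℝ) : 0 ≤ ∫ y in Set.Iic x, ρ y :=
  integral_nonneg hρ

theorem integrableOn_weight_mul_pow (hρ : ∀ y, 0 ≤ ρ y) (hi : ∀ a, IntegrableOn ρ (Set.Iic a))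
    (n : ℕ) (x : ℝ) :
    IntegrableOn (fun y => ρ y * (∫ s in Set.Iic y, ρ s) ^ n) (Set.Iic x) := by
  have hc : Continuous fun x => ∫ y in Set.Iic x, ρ y :=
    (isIndefIntegral_setIntegral_Iic hi).continuous
  refine (hi x).mul_bdd (c := (∫ s in Set.Iic x, ρ s) ^ n) (hc.pow n).aestronglyMeasurable ?_
  filter_upwards [ae_restrict_mem measurableSet_Iic] with y hy
  rw [norm_pow, Real.norm_of_nonneg (weight_primitive_nonneg hρ y)]
  exact pow_le_pow_left₀ (weight_primitive_nonneg hρ y) (weight_primitive_mono hρ hi hy) n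

/-- The iterated integrals of a weight on the simplices `y₁ ≤ y₂ ≤ ⋯ ≤ x`. -/
theorem setIntegral_weight_mul_pow (hρ : ∀ y, 0 ≤ ρ y) (hi : ∀ a, IntegrableOn ρ (Set.Iic a))
    (n : ℕ) (x : ℝ) :
    ∫ y in Set.Iic x, ρ y * (∫ s in Set.Iic y, ρ s) ^ n =
      (∫ s in Set.Iic x, ρ s) ^ (n + 1) / (n + 1) := by
  have h1 := (isIndefIntegral_setIntegral_Iic hi).pow n
  have h2 : Tendsto (fun a : ℝ => ∫ y in a..x, ρ y * (∫ s in Set.Iic y, ρ s) ^ n) atBot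
      (𝓝 (∫ y in Set.Iic x, ρ y * (∫ s in Set.Iic y, ρ s) ^ n)) :=
    intervalIntegral_tendsto_integral_Iic x (integrableOn_weight_mul_pow hρ hi n x) tendsto_id
  -- The fundamental theorem on `[a, x]` gives the formula with a boundary term at `a`, which
  -- vanishes as `a → -∞`.
  have h3 : Tendsto (fun a : ℝ => ((∫ s in Set.Iic x, ρ s) ^ (n + 1)
      - (∫ s in Set.Iic a, ρ s) ^ (n + 1)) / (n + 1)) atBot
      (𝓝 (((∫ s in Set.Iic x, ρ s) ^ (n + 1) - 0 ^ (n + 1)) / (n + 1))) :=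
    ((tendsto_const_nhds).sub ((tendsto_integral_Iic_zero tendsto_id).pow _)).div_const _
  have h4 : (fun a : ℝ => ((∫ s in Set.Iic x, ρ s) ^ (n + 1)
      - (∫ s in Set.Iic a, ρ s) ^ (n + 1)) / ((n : ℝ) + 1)) =
      fun a : ℝ => ∫ y in a..x, ρ y * (∫ s in Set.Iic y, ρ s) ^ n := by
    funext a
    have := h1.2 a x
    simp only at this
    rw [this]
    rw [intervalIntegral.integral_const_mul]
    field_simp
  rw [h4] at h3
  simpa using tendsto_nhds_unique h2 h3

/-- A Grönwall lemma on a left half-line with an integrable weight. -/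
theorem eq_zero_of_norm_le_setIntegral {E : Type*} [NormedAddCommGroup E] {h : ℝ → E} {D : ℝ}
    (hD : 0 ≤ D) (hρ : ∀ y, 0 ≤ ρ y) (hi : ∀ a, IntegrableOn ρ (Set.Iic a)) (hc : Continuous h)
    (hb : ∀ a, ∃ B, ∀ x ≤ a, ‖h x‖ ≤ B)
    (hle : ∀ x, ‖h x‖ ≤ D * ∫ y in Set.Iic x, ρ y * ‖h y‖) (x : ℝ) : h x = 0 := by
  obtain ⟨B, hB⟩ := hb x
  -- Each iteration of the inequality gains a factor `D` and one more simplex integral; the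
  -- resulting `c ^ n / n!` tends to zero.
  have key : ∀ n : ℕ, ∀ y ≤ x, ‖h y‖ ≤ B * D ^ n * ((∫ s in Set.Iic y, ρ s) ^ n / n.factorial) := by
    intro n
    induction n with
    | zero => intro y hy; simpa using hB y hy
    | succ n ih =>
      intro y hy
      refine (hle y).trans ?_
      have hint : IntegrableOn (fun s => (B * D ^ n / n.factorial) *
          (ρ s * (∫ r in Set.Iic s, ρ r) ^ n)) (Set.Iic y) :=
        (integrableOn_weight_mul_pow hρ hi n y).const_mul _
      have h1 : ∫ s in Set.Iic y, ρ s * ‖h s‖ ≤ ∫ s in Set.Iic y, (B * D ^ n / n.factorial) *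
          (ρ s * (∫ r in Set.Iic s, ρ r) ^ n) := by
        refine setIntegral_mono_on ?_ hint measurableSet_Iic ?_
        · refine (hi y).mul_bdd (c := B) hc.norm.aestronglyMeasurable ?_
          filter_upwards [ae_restrict_mem measurableSet_Iic] with s hs
          rw [norm_norm]
          exact hB s (le_trans hs hy)
        · intro s hs
          calc ρ s * ‖h s‖ ≤ ρ s * (B * D ^ n * ((∫ r in Set.Iic s, ρ r) ^ n / n.factorial)) :=
                mul_le_mul_of_nonneg_left (ih s (le_trans hs hy)) (hρ s)
            _ = _ := by ring
      rw [integral_const_mul, setIntegral_weight_mul_pow hρ hi] at h1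
      refine (mul_le_mul_of_nonneg_left h1 hD).trans (le_of_eq ?_)
      rw [Nat.factorial_succ]
      push_cast
      field_simp
      ring
  have hlim : Tendsto (fun n : ℕ => B * ((D * ∫ s in Set.Iic x, ρ s) ^ n / n.factorial)) atTop
      (𝓝 (B * 0)) := (FloorSemiring.tendsto_pow_div_factorial_atTop _).const_mul B
  rw [mul_zero] at hlim
  have : ‖h x‖ ≤ 0 := ge_of_tendsto' hlim fun n => (key n x le_rfl).trans (le_of_eq (by
    rw [mul_pow]; ring))
  simpa using this

end Weight

/-! ### Holomorphy under the integral sign. -/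

/-- A dominated integral of functions that are holomorphic in a parameter is holomorphic. -/
theorem differentiableOn_integral_of_dominated {α E : Type*} [MeasurableSpace α] {μ : Measure α}
    [NormedAddCommGroup E] [NormedSpace ℂ E] [CompleteSpace E] {f : ℂ → α → E} {U : Set ℂ}
    {bound : α → ℝ} (hU : IsOpen U) (hm : ∀ z ∈ U, AEStronglyMeasurable (f z) μ)
    (hd : ∀ᵐ y ∂μ, DifferentiableOn ℂ (fun z => f z y) U)
    (hb : ∀ᵐ y ∂μ, ∀ z ∈ U, ‖f z y‖ ≤ bound y) (hbi : Integrable bound μ) :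
    DifferentiableOn ℂ (fun z => ∫ y, f z y ∂μ) U := by
  intro z₀ hz₀
  refine DifferentiableAt.differentiableWithinAt ?_
  obtain ⟨r, hr, hrU⟩ := Metric.isOpen_iff.1 hU z₀ hz₀
  -- Discs of radius `r / 4` about points of the `r / 2`-ball stay in `U`, so Cauchy's estimate
  -- bounds the derivative there by `bound y / (r / 4)`.
  have hball : ∀ w ∈ Metric.ball z₀ (r / 2), Metric.closedBall w (r / 4) ⊆ U := by
    intro w hw
    refine (Metric.closedBall_subset_ball' ?_).trans hrU
    have := Metric.mem_ball.1 hw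
    linarith
  have hfi : ∀ z ∈ U, Integrable (f z) μ := fun z hz =>
    hbi.mono' (hm z hz) (hb.mono fun y hy => hy z hz)
  have hda : ∀ᵐ y ∂μ, ∀ w ∈ U, HasDerivAt (fun z => f z y) (deriv (fun z => f z y) w) w :=
    hd.mono fun y hy w hw => ((hy w hw).differentiableAt (hU.mem_nhds hw)).hasDerivAt
  refine (hasDerivAt_integral_of_dominated_loc_of_deriv_le
    (F' := fun w y => deriv (fun z => f z y) w) (bound := fun y => bound y / (r / 4))
    (Metric.ball_mem_nhds z₀ (half_pos hr)) ?_ (hfi z₀ hz₀) ?_ ?_ (hbi.div_const _)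
    ?_).2.differentiableAt
  · filter_upwards [hU.mem_nhds hz₀] with z hz using hm z hz
  · have hseq : ∀ n : ℕ, z₀ + ((r / 2 / (n + 1) : ℝ) : ℂ) ∈ U := by
      intro n
      refine hrU ?_
      rw [Metric.mem_ball, dist_eq_norm, add_sub_cancel_left, Complex.norm_real,
        Real.norm_of_nonneg (by positivity)]
      have : r / 2 / (n + 1) ≤ r / 2 := div_le_self (by positivity) (by
        have : (0 : ℝ) ≤ n := n.cast_nonneg
        linarith)
      linarith
    refine aestronglyMeasurable_of_tendsto_ae atTop (f := fun (n : ℕ) y =>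
      ((r / 2 / (n + 1) : ℝ) : ℂ)⁻¹ • (f (z₀ + ((r / 2 / (n + 1) : ℝ) : ℂ)) y - f z₀ y)) ?_ ?_
    · exact fun n => ((hm _ (hseq n)).sub (hm _ hz₀)).const_smul _
    · filter_upwards [hda] with y hy
      have h1 := (hasDerivAt_iff_tendsto_slope_zero.1 (hy z₀ hz₀))
      refine h1.comp (tendsto_nhdsWithin_iff.2 ⟨?_, ?_⟩)
      · have : Tendsto (fun n : ℕ => (r / 2) / ((n : ℝ) + 1)) atTop (𝓝 0) := by
          simpa [div_eq_mul_inv] using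
            (tendsto_one_div_add_atTop_nhds_zero_nat (𝕜 := ℝ)).const_mul (r / 2)
        simpa [Function.comp_def] using (Complex.continuous_ofReal.tendsto 0).comp this
      · refine Eventually.of_forall fun n => ?_
        simp only [Set.mem_compl_iff, Set.mem_singleton_iff, Complex.ofReal_eq_zero]
        positivity
  · filter_upwards [hd, hb] with y h1 h2 w hw
    refine Complex.norm_deriv_le_of_forall_mem_sphere_norm_le (by positivity) ?_ ?_
    · exact (h1.mono (hball w hw)).diffContOnCl_ball subset_rfl
    · exact fun z hz => h2 z (hball w hw (Metric.sphere_subset_closedBall hz))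
  · filter_upwards [hda] with y hy w hw
    exact hy w (hball w hw (Metric.mem_closedBall_self (by positivity)))

/-! ### Volterra equations on a left half-line, depending on a complex parameter. -/

section Volterra

variable {ι : Type*} [Fintype ι]

/-- A kernel on `{y ≤ x}` that depends continuously on `x` and on the parameter `z ∈ S`, and is
bounded as an operator by the weight `D * ρ y`. -/
structure IsVolterraKernel (G : ℂ → ℝ → ℝ → Matrix ι ι ℂ) (ρ : ℝ → ℝ) (D : ℝ) (S : Set ℂ) :
    Prop where
  nonneg : 0 ≤ D
  bound : ∀ z ∈ S, ∀ x, ∀ y ≤ x, ∀ v, ‖(G z x y).mulVec v‖ ≤ D * ρ y * ‖v‖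
  meas : ∀ z ∈ S, ∀ x i k, AEStronglyMeasurable (fun y => G z x y i k)
  cont_right : ∀ z ∈ S, ∀ y i k, Continuous fun x => G z x y i k
  cont_param : ∀ x y i k, ContinuousOn (fun z => G z x y i k) S

/-- The terms of the Neumann series of the Volterra equation with kernel `G` and free term `b`. -/
noncomputable def volterraTerm (G : ℂ → ℝ → ℝ → Matrix ι ι ℂ) (b : ℂ → ι → ℂ) :
    ℕ → ℂ → ℝ → ι → ℂ
  | 0, z, _ => b z
  | n + 1, z, x => ∫ y in Set.Iic x, (G z x y).mulVec (volterraTerm G b n z y)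

/-- The sum of the Neumann series. -/
noncomputable def volterraSum (G : ℂ → ℝ → ℝ → Matrix ι ι ℂ) (b : ℂ → ι → ℂ) (z : ℂ) (x : ℝ) :
    ι → ℂ :=
  ∑' n, volterraTerm G b n z x

variable {G : ℂ → ℝ → ℝ → Matrix ι ι ℂ} {ρ : ℝ → ℝ} {D B : ℝ} {S U : Set ℂ} {b : ℂ → ι → ℂ}

namespace IsVolterraKernel

theorem mono {S' : Set ℂ} (h : IsVolterraKernel G ρ D S) (hS : S' ⊆ S) :
    IsVolterraKernel G ρ D S' :=
  ⟨h.nonneg, fun z hz => h.bound z (hS hz), fun z hz => h.meas z (hS hz),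
    fun z hz => h.cont_right z (hS hz), fun x y i k => (h.cont_param x y i k).mono hS⟩

theorem meas_mulVec (h : IsVolterraKernel G ρ D S) {z : ℂ} (hz : z ∈ S) (x : ℝ) {w : ℝ → ι → ℂ}
    (hw : Continuous w) : AEStronglyMeasurable (fun y => (G z x y).mulVec (w y)) := by
  refine (aemeasurable_pi_lambda _ fun i => ?_).aestronglyMeasurable
  simp only [Matrix.mulVec, dotProduct]
  exact (Finset.aestronglyMeasurable_fun_sum Finset.univ fun k _ =>
    (h.meas z hz x i k).mul ((continuous_apply k).comp hw).aestronglyMeasurable).aemeasurable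

theorem norm_mulVec_le (h : IsVolterraKernel G ρ D S) (hρ : ∀ y, 0 ≤ ρ y) {z : ℂ} (hz : z ∈ S)
    {x y A : ℝ} (hy : y ≤ x) {v : ι → ℂ} (hv : ‖v‖ ≤ A) :
    ‖(G z x y).mulVec v‖ ≤ D * A * ρ y := by
  refine (h.bound z hz x y hy v).trans ?_
  have := mul_le_mul_of_nonneg_left hv (mul_nonneg h.nonneg (hρ y))
  linarith

theorem integrableOn_mulVec (h : IsVolterraKernel G ρ D S) (hρ : ∀ y, 0 ≤ ρ y)
    (hi : ∀ a, IntegrableOn ρ (Set.Iic a)) {z : ℂ} (hz : z ∈ S) {w : ℝ → ι → ℂ}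
    (hw : Continuous w) {x A : ℝ} (hA : ∀ y ≤ x, ‖w y‖ ≤ A) :
    IntegrableOn (fun y => (G z x y).mulVec (w y)) (Set.Iic x) := by
  refine Integrable.mono' ((hi x).const_mul (D * A)) (h.meas_mulVec hz x hw).restrict ?_
  filter_upwards [ae_restrict_mem measurableSet_Iic] with y hy
  exact h.norm_mulVec_le hρ hz hy (hA y hy)

/-- The moving endpoint is absorbed into an indicator function, after which dominated convergence on
`Iic (x₀ + 1)` applies. -/
theorem continuous_integral (h : IsVolterraKernel G ρ D S) (hρ : ∀ y, 0 ≤ ρ y)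
    (hi : ∀ a, IntegrableOn ρ (Set.Iic a)) {z : ℂ} (hz : z ∈ S) {w : ℝ → ι → ℂ}
    (hw : Continuous w) (hb : ∀ a, ∃ A, ∀ y ≤ a, ‖w y‖ ≤ A) :
    Continuous fun x => ∫ y in Set.Iic x, (G z x y).mulVec (w y) := by
  refine continuous_iff_continuousAt.2 fun x₀ => ?_
  obtain ⟨A, hA⟩ := hb (x₀ + 1)
  have e : (fun x => ∫ y in Set.Iic x, (G z x y).mulVec (w y)) =
      fun x => ∫ y, (Set.Iic x).indicator (fun y => (G z x y).mulVec (w y)) y := by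
    funext x
    rw [integral_indicator measurableSet_Iic]
  rw [e]
  have hA0 : 0 ≤ A := (norm_nonneg _).trans (hA x₀ (by linarith))
  refine continuousAt_of_dominated
    (bound := (Set.Iic (x₀ + 1)).indicator fun y => D * A * ρ y) ?_ ?_ ?_ ?_
  · exact Eventually.of_forall fun x => (h.meas_mulVec hz x hw).indicator measurableSet_Iic
  · filter_upwards [Iio_mem_nhds (show x₀ < x₀ + 1 by linarith)] with x hx
    refine Eventually.of_forall fun y => ?_
    by_cases hy : y ≤ x
    · have hy' : y ≤ x₀ + 1 := hy.trans (le_of_lt hx)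
      rw [Set.indicator_of_mem (Set.mem_Iic.2 hy), Set.indicator_of_mem (Set.mem_Iic.2 hy')]
      exact h.norm_mulVec_le hρ hz hy (hA y hy')
    · rw [Set.indicator_of_notMem (fun hh : y ∈ Set.Iic x => hy hh), norm_zero]
      exact Set.indicator_nonneg (fun y _ => mul_nonneg (mul_nonneg h.nonneg hA0) (hρ y)) _
  · exact (integrable_indicator_iff measurableSet_Iic).2 ((hi _).const_mul _)
  -- The indicator jumps at `x₀` only for `y = x₀`, a null set.
  · filter_upwards [Measure.ae_ne volume x₀] with y hy
    have hcont : ContinuousAt (fun x => (G z x y).mulVec (w y)) x₀ := by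
      refine Continuous.continuousAt (continuous_pi fun i => ?_)
      simp only [Matrix.mulVec, dotProduct]
      exact continuous_finsetSum _ fun k _ => (h.cont_right z hz y i k).mul continuous_const
    rcases lt_or_gt_of_ne hy with hlt | hgt
    · refine hcont.congr ?_
      filter_upwards [Ioi_mem_nhds hlt] with x hx
      rw [Set.indicator_of_mem (Set.mem_Iic.2 (le_of_lt hx))]
    · refine (continuousAt_const (y := (0 : ι → ℂ))).congr ?_
      filter_upwards [Iio_mem_nhds hgt] with x hx
      rw [Set.indicator_of_notMem (fun hh => absurd (Set.mem_Iic.1 hh) (not_le.2 hx))]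

theorem continuousOn_integral_param (h : IsVolterraKernel G ρ D S) (hρ : ∀ y, 0 ≤ ρ y)
    (hi : ∀ a, IntegrableOn ρ (Set.Iic a)) {w : ℂ → ℝ → ι → ℂ} {x A : ℝ}
    (hw : ∀ z ∈ S, Continuous (w z)) (hwz : ∀ y, ContinuousOn (fun z => w z y) S)
    (hA : ∀ z ∈ S, ∀ y ≤ x, ‖w z y‖ ≤ A) :
    ContinuousOn (fun z => ∫ y in Set.Iic x, (G z x y).mulVec (w z y)) S := by
  refine continuousOn_of_dominated (bound := fun y => D * A * ρ y) ?_ ?_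
    ((hi x).const_mul _) ?_
  · exact fun z hz => (h.meas_mulVec hz x (hw z hz)).restrict
  · intro z hz
    filter_upwards [ae_restrict_mem measurableSet_Iic] with y hy
    exact h.norm_mulVec_le hρ hz hy (hA z hz y hy)
  · refine Eventually.of_forall fun y => continuousOn_pi.2 fun i => ?_
    simp only [Matrix.mulVec, dotProduct]
    exact continuousOn_finsetSum _ fun k _ =>
      (h.cont_param x y i k).mul ((continuous_apply k).comp_continuousOn (hwz y))

theorem differentiableOn_integral_param (h : IsVolterraKernel G ρ D S) (hρ : ∀ y, 0 ≤ ρ y)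
    (hi : ∀ a, IntegrableOn ρ (Set.Iic a)) (hS : IsOpen S) {w : ℂ → ℝ → ι → ℂ} {x A : ℝ}
    (hG : ∀ y i k, DifferentiableOn ℂ (fun z => G z x y i k) S)
    (hw : ∀ z ∈ S, Continuous (w z)) (hwz : ∀ y, DifferentiableOn ℂ (fun z => w z y) S)
    (hA : ∀ z ∈ S, ∀ y ≤ x, ‖w z y‖ ≤ A) :
    DifferentiableOn ℂ (fun z => ∫ y in Set.Iic x, (G z x y).mulVec (w z y)) S := by
  refine differentiableOn_integral_of_dominated (bound := fun y => D * A * ρ y) hS ?_ ?_ ?_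
    ((hi x).const_mul _)
  · exact fun z hz => (h.meas_mulVec hz x (hw z hz)).restrict
  · refine Eventually.of_forall fun y => differentiableOn_pi.2 fun i => ?_
    simp only [Matrix.mulVec, dotProduct]
    exact DifferentiableOn.fun_sum fun k _ =>
      (hG y i k).mul (differentiableOn_pi.1 (hwz y) k)
  · filter_upwards [ae_restrict_mem measurableSet_Iic] with y hy z hz
    exact h.norm_mulVec_le hρ hz hy (hA z hz y hy)

/-- Integrating the bound for the previous term against `ρ` raises the power of the primitive of `ρ`
by one and supplies the factor `1 / (n + 1)`. The factorial makes the series converge for every size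
of `D` and `ρ`. -/
theorem norm_volterraTerm_le (h : IsVolterraKernel G ρ D S) (hρ : ∀ y, 0 ≤ ρ y)
    (hi : ∀ a, IntegrableOn ρ (Set.Iic a)) (hB : ∀ z ∈ S, ‖b z‖ ≤ B) (n : ℕ) {z : ℂ}
    (hz : z ∈ S) (x : ℝ) :
    ‖volterraTerm G b n z x‖ ≤ B * ((D * ∫ s in Set.Iic x, ρ s) ^ n / n.factorial) := by
  induction n generalizing x with
  | zero => simpa [volterraTerm] using hB z hz
  | succ n ih =>
    have hint : IntegrableOn (fun s => (B * D ^ (n + 1) / n.factorial) *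
        (ρ s * (∫ r in Set.Iic s, ρ r) ^ n)) (Set.Iic x) :=
      (integrableOn_weight_mul_pow hρ hi n x).const_mul _
    have h1 : ‖volterraTerm G b (n + 1) z x‖ ≤ ∫ s in Set.Iic x, (B * D ^ (n + 1) / n.factorial) *
        (ρ s * (∫ r in Set.Iic s, ρ r) ^ n) := by
      refine norm_integral_le_of_norm_le hint ?_
      filter_upwards [ae_restrict_mem measurableSet_Iic] with y hy
      refine (h.norm_mulVec_le hρ hz hy (ih y)).trans (le_of_eq ?_)
      rw [mul_pow, pow_succ]
      ring
    rw [integral_const_mul, setIntegral_weight_mul_pow hρ hi] at h1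
    refine h1.trans (le_of_eq ?_)
    rw [Nat.factorial_succ, mul_pow]
    push_cast
    field_simp

/-- The primitive of `ρ` is monotone, so its value at `x` gives a bound uniform on `Iic x`; this is
what dominated convergence and the M-test use. -/
theorem norm_volterraTerm_le_of_le (h : IsVolterraKernel G ρ D S) (hρ : ∀ y, 0 ≤ ρ y)
    (hi : ∀ a, IntegrableOn ρ (Set.Iic a)) (hB : ∀ z ∈ S, ‖b z‖ ≤ B) (n : ℕ) {z : ℂ}
    (hz : z ∈ S) {x y : ℝ} (hy : y ≤ x) :
    ‖volterraTerm G b n z y‖ ≤ B * ((D * ∫ s in Set.Iic x, ρ s) ^ n / n.factorial) := by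
  refine (h.norm_volterraTerm_le hρ hi hB n hz y).trans ?_
  have hB0 : 0 ≤ B := (norm_nonneg _).trans (hB z hz)
  have h0 := mul_nonneg h.nonneg (weight_primitive_nonneg hρ y)
  have h1 := mul_le_mul_of_nonneg_left (weight_primitive_mono hρ hi hy) h.nonneg
  simp only at h1
  gcongr

theorem summable_volterraBound (B c : ℝ) : Summable fun n : ℕ => B * (c ^ n / n.factorial) :=
  (Real.summable_pow_div_factorial c).mul_left B

theorem continuous_volterraTerm (h : IsVolterraKernel G ρ D S) (hρ : ∀ y, 0 ≤ ρ y)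
    (hi : ∀ a, IntegrableOn ρ (Set.Iic a)) (hB : ∀ z ∈ S, ‖b z‖ ≤ B) (n : ℕ) {z : ℂ}
    (hz : z ∈ S) : Continuous (volterraTerm G b n z) := by
  induction n with
  | zero => exact continuous_const
  | succ n ih =>
    exact h.continuous_integral hρ hi hz ih fun a =>
      ⟨_, fun y hy => h.norm_volterraTerm_le_of_le hρ hi hB n hz hy⟩

theorem continuousOn_volterraTerm (h : IsVolterraKernel G ρ D S) (hρ : ∀ y, 0 ≤ ρ y)
    (hi : ∀ a, IntegrableOn ρ (Set.Iic a)) (hB : ∀ z ∈ S, ‖b z‖ ≤ B) (hb : ContinuousOn b S)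
    (n : ℕ) (x : ℝ) : ContinuousOn (fun z => volterraTerm G b n z x) S := by
  induction n generalizing x with
  | zero => exact hb
  | succ n ih =>
    exact h.continuousOn_integral_param hρ hi
      (fun z hz => h.continuous_volterraTerm hρ hi hB n hz) ih
      fun z hz y hy => h.norm_volterraTerm_le_of_le hρ hi hB n hz hy

theorem differentiableOn_volterraTerm (h : IsVolterraKernel G ρ D S) (hρ : ∀ y, 0 ≤ ρ y)
    (hi : ∀ a, IntegrableOn ρ (Set.Iic a)) (hB : ∀ z ∈ S, ‖b z‖ ≤ B) (hS : IsOpen S)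
    (hG : ∀ x y i k, DifferentiableOn ℂ (fun z => G z x y i k) S) (hb : DifferentiableOn ℂ b S)
    (n : ℕ) (x : ℝ) : DifferentiableOn ℂ (fun z => volterraTerm G b n z x) S := by
  induction n generalizing x with
  | zero => exact hb
  | succ n ih =>
    exact h.differentiableOn_integral_param hρ hi hS (hG x)
      (fun z hz => h.continuous_volterraTerm hρ hi hB n hz) ih
      fun z hz y hy => h.norm_volterraTerm_le_of_le hρ hi hB n hz hy

theorem continuousOn_volterraSum (h : IsVolterraKernel G ρ D S) (hρ : ∀ y, 0 ≤ ρ y)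
    (hi : ∀ a, IntegrableOn ρ (Set.Iic a)) (hB : ∀ z ∈ S, ‖b z‖ ≤ B) (hb : ContinuousOn b S)
    (x : ℝ) : ContinuousOn (fun z => volterraSum G b z x) S :=
  continuousOn_tsum (fun n => h.continuousOn_volterraTerm hρ hi hB hb n x)
    (summable_volterraBound B _) fun n _ hz => h.norm_volterraTerm_le hρ hi hB n hz x

theorem differentiableOn_volterraSum (h : IsVolterraKernel G ρ D S) (hρ : ∀ y, 0 ≤ ρ y)
    (hi : ∀ a, IntegrableOn ρ (Set.Iic a)) (hB : ∀ z ∈ S, ‖b z‖ ≤ B) (hS : IsOpen S)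
    (hG : ∀ x y i k, DifferentiableOn ℂ (fun z => G z x y i k) S) (hb : DifferentiableOn ℂ b S)
    (x : ℝ) : DifferentiableOn ℂ (fun z => volterraSum G b z x) S :=
  Complex.differentiableOn_tsum_of_summable_norm (summable_volterraBound B _)
    (fun n => h.differentiableOn_volterraTerm hρ hi hB hS hG hb n x) hS
    fun n _ hz => h.norm_volterraTerm_le hρ hi hB n hz x

theorem continuous_volterraSum (h : IsVolterraKernel G ρ D S) (hρ : ∀ y, 0 ≤ ρ y)
    (hi : ∀ a, IntegrableOn ρ (Set.Iic a)) (hB : ∀ z ∈ S, ‖b z‖ ≤ B) {z : ℂ} (hz : z ∈ S) :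
    Continuous (volterraSum G b z) := by
  refine continuous_iff_continuousAt.2 fun x₀ => ?_
  refine ContinuousOn.continuousAt (s := Set.Iic (x₀ + 1)) ?_ (Iic_mem_nhds (by linarith))
  exact continuousOn_tsum (fun n => (h.continuous_volterraTerm hρ hi hB n hz).continuousOn)
    (summable_volterraBound B _) fun n y hy => h.norm_volterraTerm_le_of_le hρ hi hB n hz hy

theorem norm_volterraSum_le (h : IsVolterraKernel G ρ D S) (hρ : ∀ y, 0 ≤ ρ y)
    (hi : ∀ a, IntegrableOn ρ (Set.Iic a)) (hB : ∀ z ∈ S, ‖b z‖ ≤ B) {z : ℂ} (hz : z ∈ S)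
    {x y : ℝ} (hy : y ≤ x) :
    ‖volterraSum G b z y‖ ≤ ∑' n : ℕ, B * ((D * ∫ s in Set.Iic x, ρ s) ^ n / n.factorial) :=
  tsum_of_norm_bounded (summable_volterraBound B _).hasSum
    fun n => h.norm_volterraTerm_le_of_le hρ hi hB n hz hy

theorem integrableOn_volterraSum (h : IsVolterraKernel G ρ D S) (hρ : ∀ y, 0 ≤ ρ y)
    (hi : ∀ a, IntegrableOn ρ (Set.Iic a)) (hB : ∀ z ∈ S, ‖b z‖ ≤ B) {z : ℂ} (hz : z ∈ S)
    (x : ℝ) : IntegrableOn (fun y => (G z x y).mulVec (volterraSum G b z y)) (Set.Iic x) :=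
  h.integrableOn_mulVec hρ hi hz (h.continuous_volterraSum hρ hi hB hz)
    fun _ hy => h.norm_volterraSum_le hρ hi hB hz hy

/-- Dominated convergence exchanges sum and integral, and the integral of the `n`-th term is the
term of index `n + 1`; only the free term `b z` is left over. -/
theorem volterraSum_eq (h : IsVolterraKernel G ρ D S) (hρ : ∀ y, 0 ≤ ρ y)
    (hi : ∀ a, IntegrableOn ρ (Set.Iic a)) (hB : ∀ z ∈ S, ‖b z‖ ≤ B) {z : ℂ} (hz : z ∈ S)
    (x : ℝ) : volterraSum G b z x =
      b z + ∫ y in Set.Iic x, (G z x y).mulVec (volterraSum G b z y) := by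
  have hs : ∀ y, Summable fun n => volterraTerm G b n z y := fun y =>
    (summable_volterraBound B _).of_norm_bounded
      fun n => h.norm_volterraTerm_le hρ hi hB n hz y
  set c : ℕ → ℝ := fun n => B * ((D * ∫ s in Set.Iic x, ρ s) ^ n / n.factorial) with hc
  have hcs : Summable c := summable_volterraBound B _
  have h1 : HasSum (fun n => ∫ y in Set.Iic x, (G z x y).mulVec (volterraTerm G b n z y))
      (∫ y in Set.Iic x, (G z x y).mulVec (volterraSum G b z y)) := by
    refine hasSum_integral_of_dominated_convergence (fun n y => D * c n * ρ y) ?_ ?_ ?_ ?_ ?_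
    · exact fun n => (h.meas_mulVec hz x (h.continuous_volterraTerm hρ hi hB n hz)).restrict
    · intro n
      filter_upwards [ae_restrict_mem measurableSet_Iic] with y hy
      exact h.norm_mulVec_le hρ hz hy (h.norm_volterraTerm_le_of_le hρ hi hB n hz hy)
    · exact Eventually.of_forall fun y => (hcs.mul_left D).mul_right (ρ y)
    · have : (fun y => ∑' n, D * c n * ρ y) = fun y => (∑' n, D * c n) * ρ y := by
        funext y
        rw [tsum_mul_right]
      rw [this]
      exact (hi x).const_mul _
    · refine Eventually.of_forall fun y => ?_
      exact ((hs y).hasSum.mapL (Matrix.mulVecLin (G z x y)).toContinuousLinearMap)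
  have h2 := (hasSum_nat_add_iff' 1).2 (hs x).hasSum
  have h3 := h2.unique h1
  rw [← h3]
  simp [volterraTerm, volterraSum]

/-- The sum is bounded on a left half-line, so the integral term is at most a constant times the
tail of `ρ` at `-∞`. -/
theorem tendsto_volterraSum (h : IsVolterraKernel G ρ D S) (hρ : ∀ y, 0 ≤ ρ y)
    (hi : ∀ a, IntegrableOn ρ (Set.Iic a)) (hB : ∀ z ∈ S, ‖b z‖ ≤ B) {z : ℂ} (hz : z ∈ S) :
    Tendsto (volterraSum G b z) atBot (𝓝 (b z)) := by
  set A := ∑' n : ℕ, B * ((D * ∫ s in Set.Iic (0 : ℝ), ρ s) ^ n / n.factorial) with hA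
  have hlim : Tendsto (fun x => D * A * ∫ y in Set.Iic x, ρ y) atBot (𝓝 (D * A * 0)) :=
    (tendsto_integral_Iic_zero tendsto_id).const_mul _
  rw [mul_zero] at hlim
  rw [tendsto_iff_norm_sub_tendsto_zero]
  refine squeeze_zero' (Eventually.of_forall fun _ => norm_nonneg _) ?_ hlim
  filter_upwards [Iic_mem_atBot (0 : ℝ)] with x hx
  rw [h.volterraSum_eq hρ hi hB hz x, add_sub_cancel_left, ← integral_const_mul]
  refine norm_integral_le_of_norm_le ((hi x).const_mul _) ?_
  filter_upwards [ae_restrict_mem measurableSet_Iic] with y hy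
  exact h.norm_mulVec_le hρ hz hy (h.norm_volterraSum_le hρ hi hB hz (le_trans hy hx))

end IsVolterraKernel

/-- Solvability of a Volterra equation on a left half-line, with a solution depending continuously
on the parameter in `S` and holomorphically in the open subset `U`. -/
theorem exists_volterra_solution (hρ : ∀ y, 0 ≤ ρ y) (hi : ∀ a, IntegrableOn ρ (Set.Iic a))
    (hU : IsOpen U) (hUS : U ⊆ S) (hb : ContinuousOn b S) (hbU : DifferentiableOn ℂ b U)
    (hG : ∀ x y i k, DifferentiableOn ℂ (fun z => G z x y i k) U)
    (hloc : ∀ z ∈ S, ∃ V, IsOpen V ∧ z ∈ V ∧ ∃ D, IsVolterraKernel G ρ D (S ∩ V)) :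
    ∃ F : ℂ → ℝ → ι → ℂ, (∀ x, ContinuousOn (fun z => F z x) S) ∧
      (∀ x, DifferentiableOn ℂ (fun z => F z x) U) ∧
      ∀ z ∈ S, Continuous (F z) ∧ Tendsto (F z) atBot (𝓝 (b z)) ∧
        ∀ x, IntegrableOn (fun y => (G z x y).mulVec (F z y)) (Set.Iic x) ∧
          F z x = b z + ∫ y in Set.Iic x, (G z x y).mulVec (F z y) := by
  -- Uniform constants `D` and `B` are available only near each point; that suffices, because
  -- continuity and differentiability in `z` are local.
  have hloc' : ∀ z ∈ S, ∃ V, IsOpen V ∧ z ∈ V ∧ ∃ D B, IsVolterraKernel G ρ D (S ∩ V) ∧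
      ∀ w ∈ S ∩ V, ‖b w‖ ≤ B := by
    intro z hz
    obtain ⟨V, hV, hzV, D, hD⟩ := hloc z hz
    have h1 : {w | ‖b w‖ < ‖b z‖ + 1} ∈ 𝓝[S] z :=
      (hb z hz).norm (gt_mem_nhds (by linarith))
    obtain ⟨V', hV', hzV', hsub⟩ := mem_nhdsWithin.1 h1
    refine ⟨V ∩ V', hV.inter hV', ⟨hzV, hzV'⟩, D, ‖b z‖ + 1,
      hD.mono fun w hw => ⟨hw.1, hw.2.1⟩, fun w hw => ?_⟩
    exact le_of_lt (hsub ⟨hw.2.2, hw.1⟩)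
  refine ⟨volterraSum G b, fun x z hz => ?_, fun x z hz => ?_, fun z hz => ?_⟩
  · obtain ⟨V, hV, hzV, D, B, hK, hB⟩ := hloc' z hz
    have := hK.continuousOn_volterraSum hρ hi hB (hb.mono Set.inter_subset_left) x z ⟨hz, hzV⟩
    rwa [continuousWithinAt_inter (hV.mem_nhds hzV)] at this
  · obtain ⟨V, hV, hzV, D, B, hK, hB⟩ := hloc' z (hUS hz)
    have hsub : U ∩ V ⊆ S ∩ V := Set.inter_subset_inter_left V hUS
    have := (hK.mono hsub).differentiableOn_volterraSum hρ hi (fun w hw => hB w (hsub hw))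
      (hU.inter hV) (fun x y i k => (hG x y i k).mono Set.inter_subset_left)
      (hbU.mono Set.inter_subset_left) x z ⟨hz, hzV⟩
    rwa [differentiableWithinAt_inter (hV.mem_nhds hzV)] at this
  · obtain ⟨V, hV, hzV, D, B, hK, hB⟩ := hloc' z hz
    have hz' : z ∈ S ∩ V := ⟨hz, hzV⟩
    exact ⟨hK.continuous_volterraSum hρ hi hB hz', hK.tendsto_volterraSum hρ hi hB hz',
      fun x => ⟨hK.integrableOn_volterraSum hρ hi hB hz' x, hK.volterraSum_eq hρ hi hB hz' x⟩⟩

end Volterra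

/-! ### Reflection of the line: both ends treated as `-∞`. -/

namespace Hirota

/-- The orientation of the line that turns the given end into `-∞`. -/
def endSign : SpatialEnd → ℝ
  | SpatialEnd.minus => 1
  | SpatialEnd.plus => -1

theorem endSign_mul_self (e : SpatialEnd) (x : ℝ) : endSign e * (endSign e * x) = x := by
  cases e <;> simp [endSign]

theorem integralFrom_eq (e : SpatialEnd) (f : ℝ → Fin 3 → ℂ) (x : ℝ) :
    integralFrom e f x =
      endSign e • ∫ y in Set.Iic (endSign e * x), f (endSign e * y) := by
  cases e with
  | minus => simp [integralFrom, endSign]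
  | plus => simp [integralFrom, endSign, integral_comp_neg_Iic]

theorem integrableOn_halfLine_iff {E : Type*} [NormedAddCommGroup E] (e : SpatialEnd) (f : ℝ → E)
    (x : ℝ) : IntegrableOn f (halfLine e x) ↔
      IntegrableOn (fun y => f (endSign e * y)) (Set.Iic (endSign e * x)) := by
  cases e with
  | minus => simp [halfLine, endSign]
  | plus =>
    simp only [halfLine, endSign, neg_mul, one_mul]
    rw [← integrableOn_Ici_iff_integrableOn_Ioi]
    constructor
    · intro h
      simpa using (show IntegrableOn f (Set.Ici (-(-x))) by simpa using h).comp_neg_Iic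
    · intro h
      simpa using (IntegrableOn.comp_neg_Ici (f := fun y => f (-y)) h)

theorem tendsto_endSign_mul (e : SpatialEnd) :
    Tendsto (fun x => endSign e * x) (endFilter e) atBot := by
  cases e with
  | minus => simp only [endSign, endFilter, one_mul]; exact tendsto_id
  | plus => simpa only [endSign, endFilter, neg_one_mul] using tendsto_neg_atTop_atBot

/-- Solvability of a Volterra equation normalised at either end of the line. -/
theorem exists_volterra_solution_end (e : SpatialEnd) {G : ℂ → ℝ → ℝ → Matrix (Fin 3) (Fin 3) ℂ}
    {ρ : ℝ → ℝ} {C : ℂ → ℝ} {S U : Set ℂ} {b : ℂ → Fin 3 → ℂ}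
    (hρ : ∀ y, 0 ≤ ρ y) (hi : ∀ a, IntegrableOn ρ (halfLine e a))
    (hU : IsOpen U) (hUS : U ⊆ S) (hb : ContinuousOn b S) (hbU : DifferentiableOn ℂ b U)
    (hGU : ∀ x y i k, DifferentiableOn ℂ (fun z => G z x y i k) U)
    (hGS : ∀ x y i k, ContinuousOn (fun z => G z x y i k) S)
    (hGm : ∀ z ∈ S, ∀ x i k, AEStronglyMeasurable (fun y => G z x y i k))
    (hGx : ∀ z ∈ S, ∀ y i k, Continuous fun x => G z x y i k)
    (hC : ContinuousOn C S)
    (hbound : ∀ z ∈ S, ∀ x y, 0 ≤ endSign e * (x - y) → ∀ v,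
      ‖(G z x y).mulVec v‖ ≤ C z * ρ y * ‖v‖) :
    ∃ F : ℂ → ℝ → Fin 3 → ℂ, (∀ x, ContinuousOn (fun z => F z x) S) ∧
      (∀ x, DifferentiableOn ℂ (fun z => F z x) U) ∧
      ∀ z ∈ S, Continuous (F z) ∧ Tendsto (F z) (endFilter e) (𝓝 (b z)) ∧
        ∀ x, IntegrableOn (fun y => (G z x y).mulVec (F z y)) (halfLine e x) ∧
          F z x = b z + integralFrom e (fun y => (G z x y).mulVec (F z y)) x := by
  set ε := endSign e with hε
  have hεε : ∀ x, ε * (ε * x) = x := endSign_mul_self e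
  have hε1 : ‖ε‖ = 1 := by rw [hε]; cases e <;> simp [endSign]
  have hε0 : ε ≠ 0 := by rw [← norm_ne_zero_iff, hε1]; exact one_ne_zero
  -- The kernel in reflected variables; the extra factor `ε` is the orientation of the integral from
  -- the chosen end.
  set G' : ℂ → ℝ → ℝ → Matrix (Fin 3) (Fin 3) ℂ :=
    fun z x y => (ε : ℂ) • G z (ε * x) (ε * y) with hG'
  have hloc : ∀ z ∈ S, ∃ V, IsOpen V ∧ z ∈ V ∧ ∃ D,
      IsVolterraKernel G' (fun y => ρ (ε * y)) D (S ∩ V) := by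
    intro z hz
    have h1 : {w | C w < |C z| + 1} ∈ 𝓝[S] z :=
      (hC z hz) (gt_mem_nhds (by linarith [le_abs_self (C z)]))
    obtain ⟨V, hV, hzV, hsub⟩ := mem_nhdsWithin.1 h1
    refine ⟨V, hV, hzV, |C z| + 1, by positivity, ?_, ?_, ?_, ?_⟩
    · intro w hw x y hyx v
      simp only [hG', Matrix.smul_mulVec, norm_smul, Complex.norm_real, hε1, one_mul]
      refine (hbound w hw.1 _ _ ?_ v).trans ?_
      · rw [← mul_sub, hεε]; linarith
      · have : C w ≤ |C z| + 1 := le_of_lt (hsub ⟨hw.2, hw.1⟩)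
        have := hρ (ε * y)
        gcongr
    · intro w hw x i k
      simp only [hG', Matrix.smul_apply, smul_eq_mul]
      have hq : Measure.QuasiMeasurePreserving (fun y : ℝ => ε * y) := by
        refine ⟨measurable_const_mul ε, ?_⟩
        rw [Real.map_volume_mul_left hε0]
        exact Measure.smul_absolutelyContinuous
      exact ((hGm w hw.1 (ε * x) i k).comp_quasiMeasurePreserving hq).const_mul _
    · intro w hw y i k
      simp only [hG', Matrix.smul_apply, smul_eq_mul]
      exact continuous_const.mul ((hGx w hw.1 (ε * y) i k).comp (continuous_const_mul ε))
    · intro x y i k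
      simp only [hG', Matrix.smul_apply, smul_eq_mul]
      exact continuousOn_const.mul ((hGS _ _ i k).mono Set.inter_subset_left)
  obtain ⟨F, h1, h2, h3⟩ := exists_volterra_solution (ρ := fun y => ρ (ε * y)) (b := b)
    (G := G') (S := S) (U := U) (fun y => hρ _) (fun a => by
      have := (integrableOn_halfLine_iff e ρ (ε * a)).1 (hi _)
      rwa [endSign_mul_self] at this) hU hUS hb hbU
    (fun x y i k => by
      simp only [hG', Matrix.smul_apply, smul_eq_mul]
      exact (hGU _ _ i k).const_mul _) hloc
  refine ⟨fun z x => F z (ε * x), fun x => h1 _, fun x => h2 _, fun z hz => ?_⟩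
  obtain ⟨hc, hl, hx⟩ := h3 z hz
  refine ⟨hc.comp (continuous_const_mul ε), hl.comp (tendsto_endSign_mul e), fun x => ?_⟩
  obtain ⟨ha, hb'⟩ := hx (ε * x)
  simp only [hG', hεε, Matrix.smul_mulVec] at ha hb'
  constructor
  · rw [integrableOn_halfLine_iff]
    simp only [← hε, hεε]
    have := ha.smul (ε : ℂ)
    refine this.congr (Eventually.of_forall fun y => ?_)
    have h2 : (ε : ℂ) * ε = 1 := by exact_mod_cast (by simpa using hεε 1 : ε * ε = 1)
    simp only [Pi.smul_apply, smul_smul, h2, one_smul]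
  · rw [integralFrom_eq]
    simp only [← hε, hεε]
    rw [hb', integral_smul]
    simp

theorem exists_bound_of_tendsto_end (e : SpatialEnd) {E : Type*} [NormedAddCommGroup E]
    {h : ℝ → E} (hc : Continuous h) (hl : Tendsto h (endFilter e) (𝓝 0)) (a : ℝ) :
    ∃ B, ∀ y ≤ a, ‖h (endSign e * y)‖ ≤ B := by
  have hl' : Tendsto (fun x => h (endSign e * x)) atBot (𝓝 0) := by
    refine hl.comp (f := fun x => endSign e * x) ?_
    cases e with
    | minus => simp only [endSign, endFilter, one_mul]; exact tendsto_id
    | plus => simpa only [endSign, endFilter, neg_one_mul] using tendsto_neg_atBot_atTop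
  have h1 : ∀ᶠ y in atBot, ‖h (endSign e * y)‖ < 1 := by
    have := hl'.norm
    rw [norm_zero] at this
    exact this.eventually_lt_const one_pos
  obtain ⟨c, hc1⟩ := eventually_atBot.1 h1
  obtain ⟨B, hB⟩ := (isCompact_Icc (a := c) (b := a)).exists_bound_of_continuousOn
    (hc.comp (continuous_const_mul (endSign e))).continuousOn
  refine ⟨max 1 B, fun y hy => ?_⟩
  rcases le_total y c with hyc | hyc
  · exact (hc1 y hyc).le.trans (le_max_left _ _)
  · exact (hB y ⟨hyc, hy⟩).trans (le_max_right _ _)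

/-- A Grönwall lemma at either end of the line. -/
theorem eq_zero_of_norm_le_integral_end (e : SpatialEnd) {E : Type*} [NormedAddCommGroup E]
    {h : ℝ → E} {D : ℝ} {ρ : ℝ → ℝ} (hD : 0 ≤ D) (hρ : ∀ y, 0 ≤ ρ y)
    (hi : ∀ a, IntegrableOn ρ (halfLine e a)) (hc : Continuous h)
    (hl : Tendsto h (endFilter e) (𝓝 0))
    (hle : ∀ x, ‖h x‖ ≤ D * ∫ y in Set.Iic (endSign e * x),
      ρ (endSign e * y) * ‖h (endSign e * y)‖) (x : ℝ) : h x = 0 := by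
  have hc' : Continuous fun x => h (endSign e * x) := hc.comp (continuous_const_mul _)
  have key := eq_zero_of_norm_le_setIntegral (h := fun x => h (endSign e * x))
    (ρ := fun y => ρ (endSign e * y)) hD (fun y => hρ _) (fun a => by
      have := (integrableOn_halfLine_iff e ρ (endSign e * a)).1 (hi _)
      rwa [endSign_mul_self] at this) hc' (fun a => by
      exact exists_bound_of_tendsto_end e hc hl a) (fun y => by
      have := hle (endSign e * y)
      rwa [endSign_mul_self] at this) (endSign e * x)
  simpa only [endSign_mul_self] using key

end Hirota

/-! ### Primitives vanishing at an end, and variation of constants. -/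

namespace Hirota

theorem integral_end_tendsto_zero (e : SpatialEnd) (g : ℝ → ℂ) :
    Tendsto (fun x => (endSign e : ℂ) * ∫ y in Set.Iic (endSign e * x), g (endSign e * y))
      (endFilter e) (𝓝 0) := by
  have : (endFilter e).IsCountablyGenerated := by
    cases e <;> simp only [endFilter] <;> infer_instance
  simpa using (tendsto_integral_Iic_zero (f := fun y => g (endSign e * y)) (μ := volume)
    (tendsto_endSign_mul e)).const_mul (endSign e : ℂ)

theorem locallyIntegrable_of_halfLine (e : SpatialEnd) {E : Type*} [NormedAddCommGroup E]
    {f : ℝ → E} (h : ∀ a, IntegrableOn f (halfLine e a)) : LocallyIntegrable f := by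
  cases e with
  | minus => exact locallyIntegrable_of_integrableOn_Iic h
  | plus => exact fun x => ⟨Set.Ioi (x - 1), Ioi_mem_nhds (by linarith), h _⟩

theorem isIndefIntegral_integral_end (e : SpatialEnd) {g : ℝ → ℂ}
    (h : ∀ a, IntegrableOn g (halfLine e a)) :
    IsIndefIntegral g
      (fun x => (endSign e : ℂ) * ∫ y in Set.Iic (endSign e * x), g (endSign e * y)) := by
  refine ⟨locallyIntegrable_of_halfLine e h, fun a b => ?_⟩
  cases e with
  | minus =>
    simp only [endSign, one_mul, Complex.ofReal_one]
    exact intervalIntegral.integral_Iic_sub_Iic (h a) (h b)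
  | plus =>
    simp only [endSign, neg_mul, one_mul, Complex.ofReal_neg, Complex.ofReal_one,
      integral_comp_neg_Iic, neg_neg]
    rw [← intervalIntegral.integral_Ioi_sub_Ioi' (h a) (h b)]
    ring

/-- Two primitives of `g` differ by a constant, and here both tend to zero at the end. -/
theorem eq_integral_end (e : SpatialEnd) {g u : ℝ → ℂ} (h : ∀ a, IntegrableOn g (halfLine e a))
    (hu : IsIndefIntegral g u) (hl : Tendsto u (endFilter e) (𝓝 0)) (x : ℝ) :
    u x = (endSign e : ℂ) * ∫ y in Set.Iic (endSign e * x), g (endSign e * y) := by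
  set P := fun x => (endSign e : ℂ) * ∫ y in Set.Iic (endSign e * x), g (endSign e * y) with hP
  have hPi : IsIndefIntegral g P := isIndefIntegral_integral_end e h
  have h1 : ∀ y, u y - P y = u x - P x := fun y => by
    have h1 := hu.2 x y
    have h2 := hPi.2 x y
    linear_combination h1 - h2
  have h2 : Tendsto (fun y => u y - P y) (endFilter e) (𝓝 (0 - 0)) :=
    hl.sub (integral_end_tendsto_zero e g)
  simp only [h1, sub_zero] at h2
  have : (endFilter e).NeBot := by cases e <;> simp only [endFilter] <;> infer_instance
  exact sub_eq_zero.1 (tendsto_nhds_unique tendsto_const_nhds h2)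

/-- The sum of the moduli of the entries of a matrix. -/
noncomputable def entrySum (A : Matrix (Fin 3) (Fin 3) ℂ) : ℝ := ∑ i, ∑ k, ‖A i k‖

theorem entrySum_nonneg (A : Matrix (Fin 3) (Fin 3) ℂ) : 0 ≤ entrySum A :=
  Finset.sum_nonneg fun _ _ => Finset.sum_nonneg fun _ _ => norm_nonneg _

theorem norm_mulVec_le_entrySum (A : Matrix (Fin 3) (Fin 3) ℂ) (w : Fin 3 → ℂ) :
    ‖A.mulVec w‖ ≤ entrySum A * ‖w‖ := by
  refine (pi_norm_le_iff_of_nonneg (mul_nonneg (entrySum_nonneg A) (norm_nonneg _))).2 fun i => ?_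
  calc ‖A.mulVec w i‖ ≤ ∑ k, ‖A i k * w k‖ :=
        norm_sum_le Finset.univ fun k => A i k * w k
    _ ≤ ∑ k, ‖A i k‖ * ‖w‖ := Finset.sum_le_sum fun k _ => by
        rw [norm_mul]
        exact mul_le_mul_of_nonneg_left (norm_le_pi_norm w k) (norm_nonneg _)
    _ = (∑ k, ‖A i k‖) * ‖w‖ := (Finset.sum_mul _ _ _).symm
    _ ≤ entrySum A * ‖w‖ := by
        refine mul_le_mul_of_nonneg_right ?_ (norm_nonneg _)
        exact Finset.single_le_sum (f := fun i => ∑ k, ‖A i k‖)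
          (fun _ _ => Finset.sum_nonneg fun _ _ => norm_nonneg _) (Finset.mem_univ i)

theorem norm_diagonal_mulVec_le {d : Fin 3 → ℂ} (hd : ∀ m, ‖d m‖ ≤ 1) (w : Fin 3 → ℂ) :
    ‖(Matrix.diagonal d).mulVec w‖ ≤ ‖w‖ := by
  refine (pi_norm_le_iff_of_nonneg (norm_nonneg _)).2 fun i => ?_
  rw [Matrix.mulVec_diagonal, norm_mul]
  exact (mul_le_of_le_one_left (norm_nonneg _) (hd i)).trans (norm_le_pi_norm w i)

/-- The term in `k` cancels, so the perturbation is independent of the spectral parameter. -/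
theorem X_sub_X (k : ℂ) (u v : C2) : X k u - X k v = Complex.I • Q (u - v) := by
  ext i j
  fin_cases i <;> fin_cases j <;> simp [X, Q] <;> ring

/-- `Q u` has four possibly nonzero entries, each of modulus at most `‖u‖`; hence the constant `4`.
-/
theorem entrySum_Q_le (u : C2) : entrySum (Complex.I • Q u) ≤ 4 * ‖u‖ := by
  have h0 : ‖u 0‖ ≤ ‖u‖ := PiLp.norm_apply_le u 0
  have h1 : ‖u 1‖ ≤ ‖u‖ := PiLp.norm_apply_le u 1
  simp [entrySum, Q, Fin.sum_univ_three]
  linarith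

theorem X_sub_X_mulVec_le (k : ℂ) (u v : C2) (w : Fin 3 → ℂ) :
    ‖(X k u - X k v).mulVec w‖ ≤ 4 * ‖u - v‖ * ‖w‖ := by
  rw [X_sub_X]
  exact (norm_mulVec_le_entrySum _ _).trans
    (mul_le_mul_of_nonneg_right (entrySum_Q_le _) (norm_nonneg _))

theorem locallyIntegrable_coord {u : ℝ → C2} (hu : LocallyIntegrable u) (i : Fin 2) :
    LocallyIntegrable fun y => u y i := fun x =>
  (hu x).imp fun _ hs => ⟨hs.1, (EuclideanSpace.proj (𝕜 := ℂ) i).integrable_comp hs.2⟩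

theorem locallyIntegrable_star {u : ℝ → ℂ} (hu : LocallyIntegrable u) :
    LocallyIntegrable fun y => star (u y) := fun x =>
  (hu x).imp fun _ hs => ⟨hs.1, Complex.conjCLE.toContinuousLinearMap.integrable_comp hs.2⟩

theorem locallyIntegrable_Q {u : ℝ → C2} (hu : LocallyIntegrable u) (i k : Fin 3) :
    LocallyIntegrable fun y => Q (u y) i k := by
  have h0 := locallyIntegrable_coord hu 0
  have h1 := locallyIntegrable_coord hu 1
  have hz : LocallyIntegrable fun _ : ℝ => (0 : ℂ) := locallyIntegrable_zero
  fin_cases i <;> fin_cases k <;> first | exact hz | exact h0 | exact h1 |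
    exact (locallyIntegrable_star h0).neg | exact (locallyIntegrable_star h1).neg

theorem locallyIntegrable_X {u : ℝ → C2} (hu : LocallyIntegrable u) (κ : ℂ) (i k : Fin 3) :
    LocallyIntegrable fun y => X κ (u y) i k := by
  simp only [X, Matrix.add_apply, Matrix.smul_apply, smul_eq_mul]
  exact (locallyIntegrable_const _).add ((locallyIntegrable_Q hu i k).smul Complex.I)

theorem locallyIntegrable_mulVec {A : ℝ → Matrix (Fin 3) (Fin 3) ℂ} {φ : ℝ → Fin 3 → ℂ}
    (hA : ∀ i k, LocallyIntegrable fun y => A y i k) (hφ : Continuous φ) (i : Fin 3) :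
    LocallyIntegrable fun y => (A y).mulVec (φ y) i := by
  simp only [Matrix.mulVec, dotProduct]
  exact locallyIntegrable_finsetSum _ fun k _ =>
    IsIndefIntegral.mul_locallyIntegrable (hA i k) ((continuous_apply k).comp hφ)

/-- Passing to coordinates makes the scalar product rule for `IsIndefIntegral` available. -/
theorem solvesSpatial_iff {k : ℂ} {u : ℝ → C2} (hu : LocallyIntegrable u) {φ : ℝ → Fin 3 → ℂ}
    (hφ : Continuous φ) : SolvesSpatial k u φ ↔
      ∀ i, IsIndefIntegral (fun y => (X k (u y)).mulVec (φ y) i) (fun y => φ y i) := by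
  have hl := locallyIntegrable_mulVec (locallyIntegrable_X hu k) hφ
  have hv : ∀ a b, (∫ y in a..b, (X k (u y)).mulVec (φ y)) =
      fun i => ∫ y in a..b, (X k (u y)).mulVec (φ y) i := by
    intro a b
    funext i
    simp only [intervalIntegral, Pi.sub_apply]
    rw [eval_integral fun i => (IsIndefIntegral.intervalIntegrable (hl i) a b).1,
      eval_integral fun i => (IsIndefIntegral.intervalIntegrable (hl i) a b).2]
  constructor
  · exact fun h i => ⟨hl i, fun a b => by simpa [hv] using congrFun (h.2 a b) i⟩
  · exact fun h => ⟨hφ, fun a b => by rw [hv]; funext i; exact (h i).2 a b⟩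

/-- Variation of constants: if `X(k, u) = Y (iΛ) W + V` with `W = Y⁻¹`, then `φ` solves the spatial
equation exactly when `exp(-iΛx) W φ` is an indefinite integral of `exp(-iΛx) W V φ`. -/
theorem solvesSpatial_iff_diagonal {k : ℂ} {u : ℝ → C2} (hu : LocallyIntegrable u)
    {φ : ℝ → Fin 3 → ℂ} (hφ : Continuous φ) {P W : Matrix (Fin 3) (Fin 3) ℂ}
    {V : ℝ → Matrix (Fin 3) (Fin 3) ℂ} {d : Fin 3 → ℂ} (hPW : P * W = 1)
    (hX : ∀ y, X k (u y) = P * Matrix.diagonal (fun m => Complex.I * d m) * W + V y) :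
    SolvesSpatial k u φ ↔ ∀ m, IsIndefIntegral
      (fun y => Complex.exp (-(Complex.I * d m) * y) * (W.mulVec ((V y).mulVec (φ y))) m)
      (fun y => Complex.exp (-(Complex.I * d m) * y) * (W.mulVec (φ y)) m) := by
  have hWP : W * P = 1 := mul_eq_one_comm.1 hPW
  have hPWv : ∀ v : Fin 3 → ℂ, P.mulVec (W.mulVec v) = v := fun v => by
    rw [Matrix.mulVec_mulVec, hPW, Matrix.one_mulVec]
  have hWPv : ∀ v : Fin 3 → ℂ, W.mulVec (P.mulVec v) = v := fun v => by
    rw [Matrix.mulVec_mulVec, hWP, Matrix.one_mulVec]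
  have hXv : ∀ y, (X k (u y)).mulVec (φ y) =
      P.mulVec ((Matrix.diagonal fun m => Complex.I * d m).mulVec (W.mulVec (φ y))) +
        (V y).mulVec (φ y) := fun y => by
    rw [hX, Matrix.add_mulVec, ← Matrix.mulVec_mulVec, ← Matrix.mulVec_mulVec]
  have hWX : ∀ y m, W.mulVec ((X k (u y)).mulVec (φ y)) m =
      Complex.I * d m * W.mulVec (φ y) m + W.mulVec ((V y).mulVec (φ y)) m := fun y m => by
    rw [hXv, Matrix.mulVec_add, hWPv, Pi.add_apply, Matrix.mulVec_diagonal]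
  have hexp : ∀ m (y : ℝ), Complex.exp (Complex.I * d m * y) *
      Complex.exp (-(Complex.I * d m) * y) = 1 := fun m y => by
    rw [← Complex.exp_add]; simp
  rw [solvesSpatial_iff hu hφ]
  constructor
  · intro h m
    have h1 : IsIndefIntegral (fun y => W.mulVec ((X k (u y)).mulVec (φ y)) m)
        (fun y => W.mulVec (φ y) m) := by
      have := IsIndefIntegral.sum Finset.univ fun i _ => (h i).const_mul (W m i)
      exact this
    refine ((isIndefIntegral_cexp (-(Complex.I * d m))).mul h1).congr (fun y => ?_) fun y => rfl
    rw [hWX]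
    ring
  · intro h i
    have h1 : ∀ m, IsIndefIntegral (fun y => W.mulVec ((X k (u y)).mulVec (φ y)) m)
        (fun y => W.mulVec (φ y) m) := fun m => by
      -- Multiplying back by the inverse exponential undoes the substitution and restores the
      -- diagonal term.
      refine ((isIndefIntegral_cexp (Complex.I * d m)).mul (h m)).congr (fun y => ?_) fun y => ?_
      · rw [hWX]
        linear_combination (Complex.I * d m * W.mulVec (φ y) m +
          W.mulVec ((V y).mulVec (φ y)) m) * hexp m y
      · linear_combination (W.mulVec (φ y) m) * hexp m y
    have h2 := IsIndefIntegral.sum Finset.univ fun m _ => (h1 m).const_mul (P i m)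
    refine h2.congr (fun y => ?_) fun y => ?_
    · exact congrFun (hPWv ((X k (u y)).mulVec (φ y))) i
    · exact congrFun (hPWv (φ y)) i

/-! ### Eigenvectors of the asymptotic problem. -/

/-- The explicit inverse of `Y`. -/
noncomputable def Yinv (q₀ : ℝ) (v : C2) (z : ℂ) : Matrix (Fin 3) (Fin 3) ℂ :=
  !![-Complex.I / (1 - (q₀ : ℂ) ^ 2 / z ^ 2),
      Complex.I * star (v 0) / z / (1 - (q₀ : ℂ) ^ 2 / z ^ 2),
      Complex.I * star (v 1) / z / (1 - (q₀ : ℂ) ^ 2 / z ^ 2);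
    0, v 1 / (q₀ : ℂ), -v 0 / (q₀ : ℂ);
    -(q₀ : ℂ) / z / (1 - (q₀ : ℂ) ^ 2 / z ^ 2),
      star (v 0) / (q₀ : ℂ) / (1 - (q₀ : ℂ) ^ 2 / z ^ 2),
      star (v 1) / (q₀ : ℂ) / (1 - (q₀ : ℂ) ^ 2 / z ^ 2)]

theorem one_sub_sq_div_ne_zero {q₀ : ℝ} {z : ℂ} (hz : z ≠ 0) (hz2 : z ^ 2 ≠ (q₀ : ℂ) ^ 2) :
    1 - (q₀ : ℂ) ^ 2 / z ^ 2 ≠ 0 := by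
  intro h
  apply hz2
  field_simp at h
  linear_combination h

/-- Under `hv` the determinant of `Y` is `i (1 - q₀² / z²)`, which vanishes only at the branch
points `± q₀`. -/
theorem Y_mul_Yinv {q₀ : ℝ} (hq : q₀ ≠ 0) {v : C2}
    (hv : v 0 * star (v 0) + v 1 * star (v 1) = (q₀ : ℂ) ^ 2) {z : ℂ} (hz : z ≠ 0)
    (hz2 : z ^ 2 ≠ (q₀ : ℂ) ^ 2) : Y q₀ v z * Yinv q₀ v z = 1 := by
  have hq' : (q₀ : ℂ) ≠ 0 := by exact_mod_cast hq
  have hγz : z ^ 2 - (q₀ : ℂ) ^ 2 ≠ 0 := sub_ne_zero.2 hz2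
  have e : 1 - (q₀ : ℂ) ^ 2 / z ^ 2 = (z ^ 2 - (q₀ : ℂ) ^ 2) / z ^ 2 := by field_simp
  have hI : Complex.I ^ 2 = -1 := Complex.I_sq
  -- With the conjugates as independent variables, `hv` is a polynomial relation and the entries
  -- become rational identities.
  generalize ha : star (v 0) = a at hv
  generalize hb : star (v 1) = b at hv
  ext i j
  fin_cases i <;> fin_cases j <;>
    simp only [Y, Yinv, Matrix.mul_apply, Fin.sum_univ_three, ha, hb, e] <;>
    simp <;> field_simp <;> ring_nf <;> simp only [hI] <;>
    first | ring1 | linear_combination (z ^ 2 - (q₀ : ℂ) ^ 2) * hv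

/-- The columns of `Y` are eigenvectors of `X_±`; the variable `z` uniformises `k² - λ² = q₀²`, so
the eigenvalues are rational in `z`. -/
theorem X_mul_Y {q₀ : ℝ} (hq : q₀ ≠ 0) {v : C2}
    (hv : v 0 * star (v 0) + v 1 * star (v 1) = (q₀ : ℂ) ^ 2) {z : ℂ} (hz : z ≠ 0) :
    X (kOf q₀ z) v * Y q₀ v z =
      Y q₀ v z * Matrix.diagonal fun m => Complex.I * Lam1 q₀ z m := by
  have hq' : (q₀ : ℂ) ≠ 0 := by exact_mod_cast hq
  have hI : Complex.I ^ 2 = -1 := Complex.I_sq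
  generalize ha : star (v 0) = a at hv
  generalize hb : star (v 1) = b at hv
  ext i j
  fin_cases i <;> fin_cases j <;>
    simp only [X, Q, J, Y, kOf, lam, Lam1, Matrix.mul_apply, Fin.sum_univ_three, ha, hb] <;>
    simp <;> field_simp <;> ring_nf <;>
    first | ring1 | linear_combination -2 * hv | linear_combination -2 * z ^ 2 * hv

end Hirota

/-! ### The Volterra equation of the Jost columns and its equivalence with the spectral problem. -/

namespace Hirota

theorem norm_endSign (e : SpatialEnd) : ‖endSign e‖ = 1 := by
  cases e <;> simp [endSign]

theorem X_eq_diagonal_add {q₀ : ℝ} (hq : q₀ ≠ 0) {v : C2}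
    (hv : v 0 * star (v 0) + v 1 * star (v 1) = (q₀ : ℂ) ^ 2) {z : ℂ} (hz : z ≠ 0)
    (hz2 : z ^ 2 ≠ (q₀ : ℂ) ^ 2) (u : C2) : X (kOf q₀ z) u =
      Y q₀ v z * Matrix.diagonal (fun m => Complex.I * Lam1 q₀ z m) * Yinv q₀ v z +
        (X (kOf q₀ z) u - X (kOf q₀ z) v) := by
  rw [← X_mul_Y hq hv hz, mul_assoc, Y_mul_Yinv hq hv hz hz2, mul_one]
  abel

/-- The kernel of the Volterra equation for the `j`-th column of the modified eigenfunction. -/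
noncomputable def jostKernel (q₀ : ℝ) (v : C2) (u : ℝ → C2) (j : Fin 3) (z : ℂ) (x y : ℝ) :
    Matrix (Fin 3) (Fin 3) ℂ :=
  Y q₀ v z * Matrix.diagonal (fun m => Complex.exp
    (Complex.I * ((x - y : ℝ) : ℂ) * (Lam1 q₀ z m - Lam1 q₀ z j))) * Yinv q₀ v z *
      Complex.I • Q (u y - v)

theorem jostKernel_mulVec (q₀ : ℝ) (v : C2) (u : ℝ → C2) (j : Fin 3) (z : ℂ) (x y : ℝ)
    (w : Fin 3 → ℂ) : (jostKernel q₀ v u j z x y).mulVec w =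
      (Y q₀ v z).mulVec ((Matrix.diagonal fun m => Complex.exp
        (Complex.I * ((x - y : ℝ) : ℂ) * (Lam1 q₀ z m - Lam1 q₀ z j))).mulVec
          ((Yinv q₀ v z).mulVec ((X (kOf q₀ z) (u y) - X (kOf q₀ z) v).mulVec w))) := by
  rw [jostKernel, X_sub_X, Matrix.mulVec_mulVec, Matrix.mulVec_mulVec, Matrix.mulVec_mulVec]

theorem volterraIntegrand_eq {q₀ : ℝ} {v : C2} {z : ℂ} (h : Y q₀ v z * Yinv q₀ v z = 1)
    (q : ℝ → ℝ → C2) (t : ℝ) (j : Fin 3) (w : ℝ → Fin 3 → ℂ) (x y : ℝ) :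
    volterraIntegrand q₀ v q t j z w x y =
      (jostKernel q₀ v (fun x => q x t) j z x y).mulVec (w y) := by
  rw [volterraIntegrand, Matrix.inv_eq_right_inv h, ← Matrix.smul_mulVec, jostKernel, X_sub_X]
  congr 1
  have : (Matrix.diagonal fun m => Complex.exp (Complex.I * ((x - y : ℝ) : ℂ) *
      (Lam1 q₀ z m - Lam1 q₀ z j))) =
      Complex.exp (-(Complex.I * ((x - y : ℝ) : ℂ) * Lam1 q₀ z j)) •
        expDiag ((x - y : ℝ) : ℂ) (Lam1 q₀ z) := by
    rw [expDiag, ← Matrix.diagonal_smul]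
    congr 1
    funext m
    rw [Pi.smul_apply, smul_eq_mul, ← Complex.exp_add]
    congr 1
    ring
  rw [this]
  simp only [Matrix.mul_smul, Matrix.smul_mul]
  rw [smul_comm]

/-- The exponentials have modulus `exp(-(x - y) Im(Λ_m - Λ_j))`. As `s = ± 1`, multiplying the two
sign conditions shows that the exponent is nonpositive. -/
theorem norm_jostKernel_mulVec_le {q₀ : ℝ} {v : C2} {u : ℝ → C2} {j : Fin 3} {z : ℂ} {x y : ℝ}
    {s : ℝ} (hs : ∀ m, 0 ≤ s * (Lam1 q₀ z m - Lam1 q₀ z j).im) (hs2 : s * s = 1)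
    (hxy : 0 ≤ s * (x - y)) (w : Fin 3 → ℂ) :
    ‖(jostKernel q₀ v u j z x y).mulVec w‖ ≤
      (entrySum (Y q₀ v z) * entrySum (Yinv q₀ v z) * 4) * ‖u y - v‖ * ‖w‖ := by
  rw [jostKernel_mulVec]
  have hd : ∀ m, ‖Complex.exp (Complex.I * ((x - y : ℝ) : ℂ) *
      (Lam1 q₀ z m - Lam1 q₀ z j))‖ ≤ 1 := fun m => by
    rw [Complex.norm_exp, Real.exp_le_one_iff, mul_assoc, Complex.I_mul_re, Complex.im_ofReal_mul]
    have h1 := mul_nonneg hxy (hs m)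
    have h2 : s * (x - y) * (s * (Lam1 q₀ z m - Lam1 q₀ z j).im) =
        (x - y) * (Lam1 q₀ z m - Lam1 q₀ z j).im := by
      linear_combination ((x - y) * (Lam1 q₀ z m - Lam1 q₀ z j).im) * hs2
    linarith
  calc _ ≤ entrySum (Y q₀ v z) * _ := norm_mulVec_le_entrySum _ _
    _ ≤ entrySum (Y q₀ v z) * (entrySum (Yinv q₀ v z) * (4 * ‖u y - v‖ * ‖w‖)) := by
        refine mul_le_mul_of_nonneg_left ?_ (entrySum_nonneg _)
        refine (norm_diagonal_mulVec_le hd _).trans ((norm_mulVec_le_entrySum _ _).trans ?_)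
        exact mul_le_mul_of_nonneg_left (X_sub_X_mulVec_le _ _ _ _) (entrySum_nonneg _)
    _ = _ := by ring

theorem differentiableAt_Y (q₀ : ℝ) (v : C2) {z : ℂ} (hz : z ≠ 0) (i k : Fin 3) :
    DifferentiableAt ℂ (fun z => Y q₀ v z i k) z := by
  fin_cases i <;> fin_cases k <;> simp [Y] <;> fun_prop (disch := assumption)

theorem differentiableAt_Yinv (q₀ : ℝ) (v : C2) {z : ℂ} (hz : z ≠ 0)
    (hz2 : z ^ 2 ≠ (q₀ : ℂ) ^ 2) (i k : Fin 3) :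
    DifferentiableAt ℂ (fun z => Yinv q₀ v z i k) z := by
  have h1 := one_sub_sq_div_ne_zero hz hz2
  have h2 : z ^ 2 ≠ 0 := pow_ne_zero 2 hz
  fin_cases i <;> fin_cases k <;> simp [Yinv] <;> fun_prop (disch := assumption)

theorem differentiableAt_Lam1 (q₀ : ℝ) {z : ℂ} (hz : z ≠ 0) (m : Fin 3) :
    DifferentiableAt ℂ (fun z => Lam1 q₀ z m) z := by
  fin_cases m <;> simp [Lam1, lam, kOf] <;> fun_prop (disch := assumption)

theorem jostKernel_apply (q₀ : ℝ) (v : C2) (u : ℝ → C2) (j : Fin 3) (z : ℂ) (x y : ℝ)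
    (i k : Fin 3) : jostKernel q₀ v u j z x y i k =
      ∑ l, (∑ m, Y q₀ v z i m * Complex.exp
        (Complex.I * ((x - y : ℝ) : ℂ) * (Lam1 q₀ z m - Lam1 q₀ z j)) * Yinv q₀ v z m l) *
          (Complex.I * Q (u y - v) l k) := by
  rw [jostKernel, Matrix.mul_apply]
  refine Finset.sum_congr rfl fun l _ => ?_
  rw [Matrix.mul_apply, Matrix.smul_apply, smul_eq_mul]
  simp only [Matrix.mul_diagonal]

theorem differentiableAt_jostKernel (q₀ : ℝ) (v : C2) (u : ℝ → C2) (j : Fin 3) {z : ℂ}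
    (hz : z ≠ 0) (hz2 : z ^ 2 ≠ (q₀ : ℂ) ^ 2) (x y : ℝ) (i k : Fin 3) :
    DifferentiableAt ℂ (fun z => jostKernel q₀ v u j z x y i k) z := by
  simp only [jostKernel_apply]
  refine DifferentiableAt.fun_sum fun l _ => DifferentiableAt.mul_const ?_ _
  refine DifferentiableAt.fun_sum fun m _ => ?_
  exact ((differentiableAt_Y q₀ v hz i m).mul
    (((differentiableAt_Lam1 q₀ hz m).sub (differentiableAt_Lam1 q₀ hz j)).const_mul _).cexp).mul
      (differentiableAt_Yinv q₀ v hz hz2 m l)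

theorem continuous_jostKernel (q₀ : ℝ) (v : C2) (u : ℝ → C2) (j : Fin 3) (z : ℂ) (y : ℝ)
    (i k : Fin 3) : Continuous fun x => jostKernel q₀ v u j z x y i k := by
  simp only [jostKernel_apply]
  fun_prop

theorem aestronglyMeasurable_jostKernel (q₀ : ℝ) (v : C2) {u : ℝ → C2}
    (hu : LocallyIntegrable fun x => u x - v) (j : Fin 3) (z : ℂ) (x : ℝ) (i k : Fin 3) :
    AEStronglyMeasurable fun y => jostKernel q₀ v u j z x y i k := by
  simp only [jostKernel_apply]
  refine Finset.aestronglyMeasurable_fun_sum _ fun l _ => AEStronglyMeasurable.mul ?_ ?_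
  · exact Continuous.aestronglyMeasurable (by fun_prop)
  · exact (locallyIntegrable_Q hu l k).aestronglyMeasurable.const_mul _

theorem apply_integralFrom (e : SpatialEnd) (L : (Fin 3 → ℂ) →L[ℂ] ℂ) {f : ℝ → Fin 3 → ℂ} {x : ℝ}
    (hf : IntegrableOn f (halfLine e x)) : L (integralFrom e f x) =
      (endSign e : ℂ) * ∫ y in Set.Iic (endSign e * x), L (f (endSign e * y)) := by
  rw [integralFrom_eq, ContinuousLinearMap.integral_comp_comm L
    ((integrableOn_halfLine_iff e f x).1 hf), ← Complex.coe_smul, map_smul, smul_eq_mul]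

section

variable {e : SpatialEnd} {σ q₀ : ℝ} {v : C2} {q : ℝ → ℝ → C2} {t : ℝ} {j : Fin 3} {z : ℂ}

theorem locallyIntegrable_potential (hi : ∀ a, IntegrableOn (fun x => q x t - v) (halfLine e a)) :
    LocallyIntegrable fun x => q x t := by
  have := (locallyIntegrable_of_halfLine e hi).add (locallyIntegrable_const v)
  have e : (fun x => q x t) = (fun x => q x t - v) + fun _ => v := by
    funext x
    simp
  rwa [e]

/-- After applying `exp(-i Λ₁ x) Y⁻¹` and the scalar `exp(i Δ_j)`, the integrand no longer depends
on `x`, so the Volterra equation says that each component is a constant plus a primitive. -/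
theorem solvesSpatial_of_volterra (hq : q₀ ≠ 0)
    (hv : v 0 * star (v 0) + v 1 * star (v 1) = (q₀ : ℂ) ^ 2)
    (hi : ∀ a, IntegrableOn (fun x => q x t - v) (halfLine e a))
    (hz : z ≠ 0) (hz2 : z ^ 2 ≠ (q₀ : ℂ) ^ 2) {w : ℝ → Fin 3 → ℂ} (hw : Continuous w)
    (hvol : SolvesVolterra e q₀ v q t j z w) :
    SolvesSpatial (kOf q₀ z) (fun x => q x t)
      (fun x => Complex.exp (Complex.I * Delta σ q₀ z x t j) • w x) := by
  have hYW := Y_mul_Yinv hq hv hz hz2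
  have hWY : Yinv q₀ v z * Y q₀ v z = 1 := mul_eq_one_comm.1 hYW
  have hφ : Continuous fun x : ℝ => Complex.exp (Complex.I * Delta σ q₀ z x t j) • w x := by
    have hc : Continuous fun x : ℝ => Complex.exp (Complex.I * Delta σ q₀ z x t j) := by
      simp only [Delta]
      fun_prop
    exact hc.smul hw
  rw [solvesSpatial_iff_diagonal (locallyIntegrable_potential hi) hφ hYW
    fun y => X_eq_diagonal_add hq hv hz hz2 (q y t)]
  intro m
  set g : ℝ → ℂ := fun y => Complex.exp (-(Complex.I * Lam1 q₀ z m) * y) *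
    (Yinv q₀ v z).mulVec ((X (kOf q₀ z) (q y t) - X (kOf q₀ z) v).mulVec
      (Complex.exp (Complex.I * Delta σ q₀ z y t j) • w y)) m with hg
  set L : (Fin 3 → ℂ) →L[ℂ] ℂ := (ContinuousLinearMap.proj m).comp
    (Matrix.mulVecLin (Yinv q₀ v z)).toContinuousLinearMap with hL
  have hLa : ∀ f, L f = (Yinv q₀ v z).mulVec f m := fun f => rfl
  set a : ℝ → ℂ := fun x => Complex.exp (-(Complex.I * Lam1 q₀ z m) * x) *
    Complex.exp (Complex.I * Delta σ q₀ z x t j) with ha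
  have hgL : ∀ x y, g y = a x * L (volterraIntegrand q₀ v q t j z w x y) := by
    intro x y
    rw [hLa, volterraIntegrand_eq hYW, jostKernel_mulVec, Matrix.mulVec_mulVec, hWY,
      Matrix.one_mulVec, Matrix.mulVec_diagonal]
    simp only [hg, ha, Matrix.mulVec_smul, Pi.smul_apply, smul_eq_mul, ← mul_assoc,
      ← Complex.exp_add]
    congr 2
    simp only [Delta]
    push_cast
    ring
  have hgi : ∀ x, IntegrableOn g (halfLine e x) := fun x => by
    have := (L.integrable_comp (hvol x).1).const_mul (a x)
    exact this.congr (Eventually.of_forall fun y => (hgL x y).symm)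
  -- `Y⁻¹` sends the `j`-th column of `Y` to the `j`-th unit vector; there the exponentials in `x`
  -- cancel and only the time factor `exp(i (Λ₂)_j t)` remains.
  have hc := (IsIndefIntegral.const (𝕜 := ℂ) (Complex.exp (Complex.I * (Lam2 σ q₀ z j * t)) *
    (1 : Matrix (Fin 3) (Fin 3) ℂ) m j)).add (isIndefIntegral_integral_end e hgi)
  refine hc.congr (fun y => ?_) fun x => ?_
  · simp [hg]
  · have h1 : (Yinv q₀ v z).mulVec (w x) m = (1 : Matrix (Fin 3) (Fin 3) ℂ) m j +
        L (integralFrom e (volterraIntegrand q₀ v q t j z w x) x) := by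
      rw [(hvol x).2, Matrix.mulVec_add, Pi.add_apply, ← hWY]
      rfl
    simp only [Matrix.mulVec_smul, Pi.smul_apply, smul_eq_mul]
    rw [h1, apply_integralFrom e L (hvol x).1]
    have h2 : ∫ y in Set.Iic (endSign e * x), g (endSign e * y) = a x *
        ∫ y in Set.Iic (endSign e * x),
          L (volterraIntegrand q₀ v q t j z w x (endSign e * y)) := by
      rw [← integral_const_mul]
      simp only [← hgL]
    rw [h2]
    have h3 : Complex.exp (Complex.I * (Lam2 σ q₀ z j * t)) *
        (1 : Matrix (Fin 3) (Fin 3) ℂ) m j = a x * (1 : Matrix (Fin 3) (Fin 3) ℂ) m j := by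
      by_cases hmj : m = j
      · subst hmj
        simp only [ha, ← Complex.exp_add, Delta]
        congr 2
        ring
      · simp [Matrix.one_apply_ne hmj]
    rw [h3]
    simp only [ha]
    ring

/-- Existence of the columns of the modified eigenfunction on a set `S` of spectral parameters for
which the exponentials in the Volterra equation are bounded. -/
theorem exists_modified_column {S U : Set ℂ} (hq : q₀ ≠ 0)
    (hv : v 0 * star (v 0) + v 1 * star (v 1) = (q₀ : ℂ) ^ 2)
    (hi : ∀ a, IntegrableOn (fun x => q x t - v) (halfLine e a)) (hU : IsOpen U) (hUS : U ⊆ S)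
    (hS : ∀ z ∈ S, z ≠ 0 ∧ z ^ 2 ≠ (q₀ : ℂ) ^ 2)
    (him : ∀ z ∈ S, ∀ m, 0 ≤ endSign e * (Lam1 q₀ z m - Lam1 q₀ z j).im) :
    ∃ F : ℂ → ℝ → Fin 3 → ℂ, (∀ x, ContinuousOn (fun z => F z x) S) ∧
      (∀ x, DifferentiableOn ℂ (fun z => F z x) U) ∧
      ∀ z ∈ S, IsModifiedColumn e σ q₀ v q t j z (F z) ∧
        SolvesVolterra e q₀ v q t j z (F z) := by
  have hb : ∀ z ∈ S, DifferentiableAt ℂ (fun z => fun i => Y q₀ v z i j) z := fun z hz =>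
    differentiableAt_pi.2 fun i => differentiableAt_Y q₀ v (hS z hz).1 i j
  have hK : ∀ z ∈ S, ∀ x y i k,
      DifferentiableAt ℂ (fun z => jostKernel q₀ v (fun x => q x t) j z x y i k) z :=
    fun z hz => differentiableAt_jostKernel q₀ v _ j (hS z hz).1 (hS z hz).2
  have hss : endSign e * endSign e = 1 := by simpa using endSign_mul_self e 1
  obtain ⟨F, h1, h2, h3⟩ := exists_volterra_solution_end e
    (G := jostKernel q₀ v (fun x => q x t) j) (ρ := fun y => ‖q y t - v‖)
    (C := fun z => entrySum (Y q₀ v z) * entrySum (Yinv q₀ v z) * 4)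
    (b := fun z i => Y q₀ v z i j) (S := S) (U := U) (fun y => norm_nonneg _)
    (fun a => (hi a).norm) hU hUS
    (fun z hz => (hb z hz).continuousAt.continuousWithinAt)
    (fun z hz => (hb z (hUS hz)).differentiableWithinAt)
    (fun x y i k z hz => (hK z (hUS hz) x y i k).differentiableWithinAt)
    (fun x y i k z hz => (hK z hz x y i k).continuousAt.continuousWithinAt)
    (fun z _ => aestronglyMeasurable_jostKernel q₀ v (locallyIntegrable_of_halfLine e hi) j z)
    (fun z _ => continuous_jostKernel q₀ v _ j z)
    -- Continuity of this bound in `z` is what provides locally uniform constants for the Neumann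
    -- series.
    (by
      intro z hz
      refine ContinuousAt.continuousWithinAt (ContinuousAt.mul (ContinuousAt.mul ?_ ?_)
        continuousAt_const)
      · exact tendsto_finsetSum _ fun i _ => tendsto_finsetSum _ fun k _ =>
          (differentiableAt_Y q₀ v (hS z hz).1 i k).continuousAt.norm
      · exact tendsto_finsetSum _ fun i _ => tendsto_finsetSum _ fun k _ =>
          (differentiableAt_Yinv q₀ v (hS z hz).1 (hS z hz).2 i k).continuousAt.norm)
    (fun z hz x y hxy w => norm_jostKernel_mulVec_le (him z hz) hss hxy w)
  refine ⟨F, h1, h2, fun z hz => ?_⟩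
  obtain ⟨hc, hl, hx⟩ := h3 z hz
  have hvol : SolvesVolterra e q₀ v q t j z (F z) := fun x => by
    have : volterraIntegrand q₀ v q t j z (F z) x =
        fun y => (jostKernel q₀ v (fun x => q x t) j z x y).mulVec (F z y) :=
      funext fun y =>
        volterraIntegrand_eq (Y_mul_Yinv hq hv (hS z hz).1 (hS z hz).2) q t j (F z) x y
    rw [this]
    exact hx x
  exact ⟨⟨solvesSpatial_of_volterra hq hv hi (hS z hz).1 (hS z hz).2 hc hvol, hl⟩, hvol⟩

theorem SolvesSpatial.sub {k : ℂ} {u : ℝ → C2} (hu : LocallyIntegrable u) {φ χ : ℝ → Fin 3 → ℂ}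
    (hφ : SolvesSpatial k u φ) (hχ : SolvesSpatial k u χ) :
    SolvesSpatial k u fun x => φ x - χ x := by
  rw [solvesSpatial_iff hu (φ := fun x => φ x - χ x) (hφ.1.sub hχ.1)]
  intro i
  refine (((solvesSpatial_iff hu hφ.1).1 hφ i).add
    (((solvesSpatial_iff hu hχ.1).1 hχ i).const_mul (-1))).congr (fun y => ?_) fun y => ?_
  · rw [Matrix.mulVec_sub, Pi.sub_apply]
    ring
  · simp [sub_eq_add_neg]

/-- For real `λ` and `k`, a solution of the spatial equation that vanishes at one end vanishes. -/
theorem SolvesSpatial.eq_zero (hq : q₀ ≠ 0)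
    (hv : v 0 * star (v 0) + v 1 * star (v 1) = (q₀ : ℂ) ^ 2)
    (hi : ∀ a, IntegrableOn (fun x => q x t - v) (halfLine e a))
    (hz : z ≠ 0) (hz2 : z ^ 2 ≠ (q₀ : ℂ) ^ 2) (him : ∀ m, (Lam1 q₀ z m).im = 0)
    {φ : ℝ → Fin 3 → ℂ} (hφ : SolvesSpatial (kOf q₀ z) (fun x => q x t) φ)
    (hl : Tendsto φ (endFilter e) (𝓝 0)) (x : ℝ) : φ x = 0 := by
  have hYW := Y_mul_Yinv hq hv hz hz2
  have hu := locallyIntegrable_potential hi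
  have hd := (solvesSpatial_iff_diagonal hu hφ.1 hYW
    fun y => X_eq_diagonal_add hq hv hz hz2 (q y t)).1 hφ
  have hexp : ∀ m (y : ℝ), ‖Complex.exp (-(Complex.I * Lam1 q₀ z m) * y)‖ = 1 := fun m y => by
    rw [Complex.norm_exp]
    simp [him m]
  set C := entrySum (Yinv q₀ v z) * 4 with hC
  have hC0 : 0 ≤ C := mul_nonneg (entrySum_nonneg _) (by norm_num)
  have hWv : ∀ (f : Fin 3 → ℂ) m, ‖(Yinv q₀ v z).mulVec f m‖ ≤ entrySum (Yinv q₀ v z) * ‖f‖ :=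
    fun f m => (norm_le_pi_norm _ m).trans (norm_mulVec_le_entrySum _ _)
  set g : Fin 3 → ℝ → ℂ := fun m y => Complex.exp (-(Complex.I * Lam1 q₀ z m) * y) *
    (Yinv q₀ v z).mulVec ((X (kOf q₀ z) (q y t) - X (kOf q₀ z) v).mulVec (φ y)) m with hg
  have hgb : ∀ m y, ‖g m y‖ ≤ C * (‖q y t - v‖ * ‖φ y‖) := fun m y => by
    rw [norm_mul, hexp, one_mul]
    refine (hWv _ m).trans ((mul_le_mul_of_nonneg_left (X_sub_X_mulVec_le _ _ _ _)
      (entrySum_nonneg _)).trans (le_of_eq ?_))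
    rw [hC]
    ring
  -- The solution tends to zero at the end, so it is bounded on each half-line and the product with
  -- the weight is integrable.
  have hρi : ∀ a, IntegrableOn (fun y => ‖q y t - v‖ * ‖φ y‖) (halfLine e a) := fun a => by
    obtain ⟨B, hB⟩ := exists_bound_of_tendsto_end e hφ.1 hl (endSign e * a)
    have h1 := (integrableOn_halfLine_iff e _ a).1 (hi a).norm
    rw [integrableOn_halfLine_iff]
    refine h1.mul_bdd (c := B)
      (hφ.1.comp (continuous_const_mul (endSign e))).norm.aestronglyMeasurable ?_
    filter_upwards [ae_restrict_mem measurableSet_Iic] with y hy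
    rw [norm_norm]
    exact hB y hy
  have hgi : ∀ m a, IntegrableOn (g m) (halfLine e a) := fun m a =>
    ((hρi a).const_mul C).mono' (hd m).1.aestronglyMeasurable.restrict
      (Eventually.of_forall (hgb m))
  have hlim : ∀ m, Tendsto (fun y : ℝ => Complex.exp (-(Complex.I * Lam1 q₀ z m) * y) *
      (Yinv q₀ v z).mulVec (φ y) m) (endFilter e) (𝓝 0) := fun m => by
    refine squeeze_zero_norm (a := fun y => entrySum (Yinv q₀ v z) * ‖φ y‖) (fun y => ?_) ?_
    · rw [norm_mul, hexp, one_mul]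
      exact hWv _ m
    · simpa using hl.norm.const_mul (entrySum (Yinv q₀ v z))
  refine eq_zero_of_norm_le_integral_end e (D := entrySum (Y q₀ v z) * C)
    (ρ := fun y => ‖q y t - v‖) (mul_nonneg (entrySum_nonneg _) hC0) (fun y => norm_nonneg _)
    (fun a => (hi a).norm) hφ.1 hl (fun x => ?_) x
  have hPW : φ x = (Y q₀ v z).mulVec ((Yinv q₀ v z).mulVec (φ x)) := by
    rw [Matrix.mulVec_mulVec, hYW, Matrix.one_mulVec]
  set I := ∫ y in Set.Iic (endSign e * x), ‖q (endSign e * y) t - v‖ * ‖φ (endSign e * y)‖ with hI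
  have hI0 : 0 ≤ I := integral_nonneg fun y => mul_nonneg (norm_nonneg _) (norm_nonneg _)
  have hW : ‖(Yinv q₀ v z).mulVec (φ x)‖ ≤ C * I := by
    refine (pi_norm_le_iff_of_nonneg (mul_nonneg hC0 hI0)).2 fun m => ?_
    have h1 := eq_integral_end e (hgi m) (hd m) (hlim m) x
    have h2 : ‖(Yinv q₀ v z).mulVec (φ x) m‖ =
        ‖Complex.exp (-(Complex.I * Lam1 q₀ z m) * x) * (Yinv q₀ v z).mulVec (φ x) m‖ := by
      rw [norm_mul, hexp, one_mul]
    rw [h2, h1, norm_mul, Complex.norm_real, norm_endSign, one_mul, hI, ← integral_const_mul]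
    exact norm_integral_le_of_norm_le
      (((integrableOn_halfLine_iff e _ x).1 (hρi x)).const_mul C)
      (Eventually.of_forall fun y => hgb m _)
  calc ‖φ x‖ ≤ entrySum (Y q₀ v z) * ‖(Yinv q₀ v z).mulVec (φ x)‖ := by
        conv_lhs => rw [hPW]
        exact norm_mulVec_le_entrySum _ _
    _ ≤ entrySum (Y q₀ v z) * (C * I) := mul_le_mul_of_nonneg_left hW (entrySum_nonneg _)
    _ = _ := by ring

end

end Hirota

/-! ### Signs of the exponents, and the Jost eigenfunctions on the real axis. -/

namespace Hirota

/-- Here `r = q₀² / |z|²`, because `Im (q₀² / z) = -r Im z`. -/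
theorem exists_im_lam_kOf (q₀ : ℝ) (z : ℂ) : ∃ r : ℝ, 0 ≤ r ∧
    (lam q₀ z).im = z.im * (1 + r) / 2 ∧ (kOf q₀ z).im = z.im * (1 - r) / 2 := by
  have h : ((q₀ : ℂ) ^ 2 / z).im = -(z.im * (q₀ ^ 2 / Complex.normSq z)) := by
    rw [← Complex.ofReal_pow, div_eq_mul_inv, Complex.im_ofReal_mul, Complex.inv_im]
    ring
  have h2 : ∀ w : ℂ, (w / 2).im = w.im / 2 := fun w => by
    simp
  refine ⟨q₀ ^ 2 / Complex.normSq z, div_nonneg (sq_nonneg _) (Complex.normSq_nonneg _), ?_, ?_⟩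
  · rw [lam, h2, Complex.sub_im, h]
    ring
  · rw [kOf, h2, Complex.add_im, h]
    ring

/-- The differences are `0, -z, -2λ`, with imaginary parts `0`, `-Im z`, `-(1 + r) Im z`. -/
theorem endSign_mul_im_nonneg_first (e : SpatialEnd) (q₀ : ℝ) {z : ℂ}
    (hz : endSign e * z.im ≤ 0) (m : Fin 3) :
    0 ≤ endSign e * (Lam1 q₀ z m - Lam1 q₀ z 0).im := by
  obtain ⟨r, hr, hl, hk⟩ := exists_im_lam_kOf q₀ z
  have := mul_nonneg (neg_nonneg.2 hz) hr
  fin_cases m <;> simp [Lam1, hl, hk] <;> nlinarith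

/-- The differences are `2λ, -q₀² / z, 0`, with imaginary parts `(1 + r) Im z`, `r Im z`, `0`. -/
theorem endSign_mul_im_nonneg_third (e : SpatialEnd) (q₀ : ℝ) {z : ℂ}
    (hz : 0 ≤ endSign e * z.im) (m : Fin 3) :
    0 ≤ endSign e * (Lam1 q₀ z m - Lam1 q₀ z 2).im := by
  obtain ⟨r, hr, hl, hk⟩ := exists_im_lam_kOf q₀ z
  have := mul_nonneg hz hr
  fin_cases m <;> simp [Lam1, hl, hk] <;> nlinarith

theorem Lam1_im_eq_zero (q₀ : ℝ) {z : ℂ} (hz : z.im = 0) (m : Fin 3) : (Lam1 q₀ z m).im = 0 := by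
  obtain ⟨r, hr, hl, hk⟩ := exists_im_lam_kOf q₀ z
  fin_cases m <;> simp [Lam1, hl, hk, hz]

theorem Lam2_im_eq_zero (σ q₀ : ℝ) {z : ℂ} (hz : z.im = 0) (m : Fin 3) :
    (Lam2 σ q₀ z m).im = 0 := by
  obtain ⟨r, hr, hl, hk⟩ := exists_im_lam_kOf q₀ z
  rw [hz, zero_mul, zero_div] at hl hk
  obtain ⟨l, hl'⟩ : ∃ l : ℝ, lam q₀ z = l := ⟨_, Complex.ext rfl (by simpa using hl)⟩
  obtain ⟨k, hk'⟩ : ∃ k : ℝ, kOf q₀ z = k := ⟨_, Complex.ext rfl (by simpa using hk)⟩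
  fin_cases m <;> simp [Lam2, hl', hk', ← Complex.ofReal_pow]

theorem norm_cexp_Delta (σ q₀ : ℝ) {z : ℂ} (hz : z.im = 0) (x t : ℝ) (j : Fin 3) :
    ‖Complex.exp (Complex.I * Delta σ q₀ z x t j)‖ = 1 := by
  rw [Complex.norm_exp]
  simp [Delta, Lam1_im_eq_zero q₀ hz, Lam2_im_eq_zero σ q₀ hz]

theorem regular_of_mem {q₀ : ℝ} {z : ℂ} (hz : z.im ≠ 0 ∨ z ∈ realAxis q₀) :
    z ≠ 0 ∧ z ^ 2 ≠ (q₀ : ℂ) ^ 2 := by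
  rcases hz with h | h
  · refine ⟨fun h0 => h (by simp [h0]), fun h2 => ?_⟩
    rcases sq_eq_sq_iff_eq_or_eq_neg.1 h2 with h3 | h3 <;> exact h (by simp [h3])
  · refine ⟨h.2.1, fun h2 => ?_⟩
    rcases sq_eq_sq_iff_eq_or_eq_neg.1 h2 with h3 | h3
    · exact h.2.2.1 h3
    · exact h.2.2.2 h3

section

variable {e : SpatialEnd} {σ q₀ : ℝ} {v : C2} {q : ℝ → ℝ → C2} {t : ℝ} {z : ℂ}

theorem IsJost.tendsto_column {ψ : ℝ → Matrix (Fin 3) (Fin 3) ℂ} (h : IsJost e σ q₀ v q t z ψ)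
    (j : Fin 3) : Tendsto (fun x i => ψ x i j -
      Complex.exp (Complex.I * Delta σ q₀ z x t j) * Y q₀ v z i j) (endFilter e) (𝓝 0) := by
  refine tendsto_pi_nhds.2 fun i => ?_
  have := (tendsto_pi_nhds.1 (tendsto_pi_nhds.1 h.2 i)) j
  refine this.congr fun x => ?_
  simp [expDiag, Matrix.mul_diagonal, mul_comm]

theorem IsModifiedColumn.tendsto_sub {j : Fin 3} {w : ℝ → Fin 3 → ℂ}
    (h : IsModifiedColumn e σ q₀ v q t j z w) (hz : z.im = 0) :
    Tendsto (fun x i => Complex.exp (Complex.I * Delta σ q₀ z x t j) * w x i -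
      Complex.exp (Complex.I * Delta σ q₀ z x t j) * Y q₀ v z i j) (endFilter e) (𝓝 0) := by
  refine tendsto_pi_nhds.2 fun i => ?_
  have h1 := (tendsto_pi_nhds.1 h.2 i).sub_const (Y q₀ v z i j)
  rw [sub_self] at h1
  have h2 := h1.norm
  rw [norm_zero] at h2
  refine squeeze_zero_norm (fun x => le_of_eq ?_) h2
  rw [← mul_sub, norm_mul, norm_cexp_Delta σ q₀ hz, one_mul]

/-- On the real axis, the columns of a Jost eigenfunction are determined by the modified
columns. -/
theorem IsJost.column_eq (hq : q₀ ≠ 0)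
    (hv : v 0 * star (v 0) + v 1 * star (v 1) = (q₀ : ℂ) ^ 2)
    (hi : ∀ a, IntegrableOn (fun x => q x t - v) (halfLine e a)) (hz : z ∈ realAxis q₀)
    {ψ : ℝ → Matrix (Fin 3) (Fin 3) ℂ} (h : IsJost e σ q₀ v q t z ψ) {j : Fin 3}
    {w : ℝ → Fin 3 → ℂ} (hw : IsModifiedColumn e σ q₀ v q t j z w) (x : ℝ) (i : Fin 3) :
    ψ x i j = Complex.exp (Complex.I * Delta σ q₀ z x t j) * w x i := by
  have hr := regular_of_mem (Or.inr hz)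
  have hl : Tendsto (fun x => (fun i => ψ x i j) -
      Complex.exp (Complex.I * Delta σ q₀ z x t j) • w x) (endFilter e) (𝓝 0) := by
    have := (h.tendsto_column j).sub (hw.tendsto_sub hz.1)
    rw [sub_zero] at this
    refine this.congr fun x => ?_
    funext i
    simp
  have := ((h.1 j).sub (locallyIntegrable_potential hi) hw.1).eq_zero hq hv hi hr.1 hr.2
    (Lam1_im_eq_zero q₀ hz.1) hl x
  exact sub_eq_zero.1 (congrFun this i)

theorem existsUnique_isJost (hq : q₀ ≠ 0)
    (hv : v 0 * star (v 0) + v 1 * star (v 1) = (q₀ : ℂ) ^ 2)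
    (hi : ∀ a, IntegrableOn (fun x => q x t - v) (halfLine e a)) (hz : z ∈ realAxis q₀) :
    ∃! ψ, IsJost e σ q₀ v q t z ψ := by
  have hF : ∀ j, ∃ w : ℝ → Fin 3 → ℂ, IsModifiedColumn e σ q₀ v q t j z w := fun j => by
    -- On the axis all exponents are purely oscillatory, so every column is admissible, the second
    -- included; no holomorphy is needed, hence `U = ∅`.
    obtain ⟨F, -, -, h⟩ := exists_modified_column (σ := σ) (j := j) (S := realAxis q₀)
      (U := ∅) hq hv hi isOpen_empty (Set.empty_subset _) (fun z hz => regular_of_mem (Or.inr hz))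
      (fun z hz m => by simp [Lam1_im_eq_zero q₀ hz.1])
    exact ⟨F z, (h z hz).1⟩
  choose w hw using hF
  refine ⟨fun x i j => Complex.exp (Complex.I * Delta σ q₀ z x t j) * w j x i,
    ⟨fun j => (hw j).1, ?_⟩, fun ψ hψ => ?_⟩
  · refine tendsto_pi_nhds.2 fun i => tendsto_pi_nhds.2 fun j => ?_
    refine (tendsto_pi_nhds.1 ((hw j).tendsto_sub hz.1) i).congr fun x => ?_
    change _ = Complex.exp (Complex.I * Delta σ q₀ z x t j) * w j x i -
      (Y q₀ v z * expDiag 1 (Delta σ q₀ z x t)) i j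
    simp [expDiag, Matrix.mul_diagonal, mul_comm]
  · funext x i j
    exact hψ.column_eq hq hv hi hz (hw j) x i

/-- A single Volterra solution lives on `U` together with the axis; uniqueness on the axis
identifies its boundary values with the Jost column. -/
theorem columnExtends {U : Set ℂ} {j : Fin 3} (hq : q₀ ≠ 0)
    (hv : v 0 * star (v 0) + v 1 * star (v 1) = (q₀ : ℂ) ^ 2)
    (hi : ∀ a, IntegrableOn (fun x => q x t - v) (halfLine e a)) (hU : IsOpen U)
    (hU0 : ∀ z ∈ U, z.im ≠ 0)
    (him : ∀ z ∈ U, ∀ m, 0 ≤ endSign e * (Lam1 q₀ z m - Lam1 q₀ z j).im) :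
    ColumnExtends e σ q₀ v q t j U := by
  obtain ⟨F, h1, h2, h3⟩ := exists_modified_column (σ := σ) (j := j) (S := U ∪ realAxis q₀)
    (U := U) hq hv hi hU Set.subset_union_left
    (fun z hz => regular_of_mem (hz.imp_left (hU0 z)))
    (fun z hz m => hz.elim (fun h => him z h m) fun h => by simp [Lam1_im_eq_zero q₀ h.1])
  refine ⟨F, fun x => (h2 x).analyticOnNhd hU, h1, fun z hz ψ hψ x => ?_,
    fun z hz => (h3 z (Or.inl hz)).1, fun z hz => (h3 z hz).2⟩
  funext i
  have h4 : Complex.exp (Complex.I * (-1) * Delta σ q₀ z x t j) *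
      Complex.exp (Complex.I * Delta σ q₀ z x t j) = 1 := by
    rw [← Complex.exp_add]
    simp
  rw [modified, expDiag, Matrix.mul_diagonal, hψ.column_eq hq hv hi hz (h3 z (Or.inr hz)).1 x i]
  linear_combination -(F z x i) * h4

theorem isOpen_upperHalf : IsOpen upperHalf := isOpen_lt continuous_const Complex.continuous_im

theorem isOpen_lowerHalf : IsOpen lowerHalf := isOpen_lt Complex.continuous_im continuous_const

end

theorem mul_star_add_of_eq_smul {u v : C2} {δ : ℝ} (h : v = Complex.exp (Complex.I * δ) • u) :
    v 0 * star (v 0) + v 1 * star (v 1) = (‖u‖ : ℂ) ^ 2 := by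
  have h1 : ‖v‖ = ‖u‖ := by
    rw [h, norm_smul, mul_comm Complex.I, Complex.norm_exp_ofReal_mul_I, one_mul]
  rw [← h1, ← Complex.ofReal_pow, EuclideanSpace.norm_sq_eq, Fin.sum_univ_two]
  push_cast
  rw [← Complex.mul_conj', ← Complex.mul_conj']
  rfl

end Hirota

open Hirota in
theorem theorem1 (σ : ℝ) (qvec : C2) (hqvec : qvec ≠ 0) (δm δp : ℝ) (qm qp : C2)
    (hqm : qm = Complex.exp (Complex.I * δm) • qvec)
    (hqp : qp = Complex.exp (Complex.I * δp) • qvec)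
    (q : ℝ → ℝ → C2) (t : ℝ) :
    ((∀ a : ℝ, IntegrableOn (fun x => q x t - qm) (Set.Iio a)) →
      (∀ z ∈ realAxis ‖qvec‖, ∃! ψ, IsJost SpatialEnd.minus σ ‖qvec‖ qm q t z ψ) ∧
      ColumnExtends SpatialEnd.minus σ ‖qvec‖ qm q t 0 lowerHalf ∧
      ColumnExtends SpatialEnd.minus σ ‖qvec‖ qm q t 2 upperHalf) ∧
    ((∀ a : ℝ, IntegrableOn (fun x => q x t - qp) (Set.Ioi a)) →
      (∀ z ∈ realAxis ‖qvec‖, ∃! ψ, IsJost SpatialEnd.plus σ ‖qvec‖ qp q t z ψ) ∧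
      ColumnExtends SpatialEnd.plus σ ‖qvec‖ qp q t 2 lowerHalf ∧
      ColumnExtends SpatialEnd.plus σ ‖qvec‖ qp q t 0 upperHalf) := by
  have hq : ‖qvec‖ ≠ 0 := norm_ne_zero_iff.2 hqvec
  have hl : ∀ z ∈ lowerHalf, z.im < 0 := fun _ h => h
  have hu : ∀ z ∈ upperHalf, 0 < z.im := fun _ h => h
  constructor
  · intro h
    have hv := mul_star_add_of_eq_smul hqm
    -- The half-line at `-∞` is closed while the hypothesis concerns open ones; moving the endpoint
    -- by one covers it.
    have hi : ∀ a, IntegrableOn (fun x => q x t - qm) (halfLine SpatialEnd.minus a) := fun a =>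
      (h (a + 1)).mono_set (Set.Iic_subset_Iio.2 (lt_add_one a))
    refine ⟨fun z hz => existsUnique_isJost hq hv hi hz,
      columnExtends hq hv hi isOpen_lowerHalf (fun z hz => (hl z hz).ne) fun z hz =>
        endSign_mul_im_nonneg_first _ _ ?_,
      columnExtends hq hv hi isOpen_upperHalf (fun z hz => (hu z hz).ne') fun z hz =>
        endSign_mul_im_nonneg_third _ _ ?_⟩
    · simpa [endSign] using (hl z hz).le
    · simpa [endSign] using (hu z hz).le
  · intro h
    have hv := mul_star_add_of_eq_smul hqp
    -- At `+∞` the sign of `x - y` is reversed, so the first and third columns exchange half-planes.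
    refine ⟨fun z hz => existsUnique_isJost hq hv h hz,
      columnExtends hq hv h isOpen_lowerHalf (fun z hz => (hl z hz).ne) fun z hz =>
        endSign_mul_im_nonneg_third _ _ ?_,
      columnExtends hq hv h isOpen_upperHalf (fun z hz => (hu z hz).ne') fun z hz =>
        endSign_mul_im_nonneg_first _ _ ?_⟩
    · simpa [endSign] using (hl z hz).le
    · simpa [endSign] using (hu z hz).le
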